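/- **Conventions.** Partially ordered abelian groups $G$, with positive cone $G^+$, are taken to be directed ($G=G^+-G^+$). An element $u\in G^+$ is an *order unit* if for every $g\in G$ there is a positive integer $N$ with $-Nu\le g\le Nu$; $G$ is *simple* if every nonzero element of $G^+$ is an order unit. $G$ is a *dimension group* if it is unperforated ($n\ge 1$ and $ng\in G^+$ imply $g\in G^+$) and has Riesz decomposition (if $0\le a\le b+c$ with $b,c\in G^+$, then $a=b'+c'$ with $0\le b'\le b$ and $0\le c'\le c$). A *trace* on a partially ordered abelian group is a nonzero positive group homomorphism to $\mathbf R$. For a group with order unit $u$, $S(G,u)$ denotes the convex set of traces $\tau$ with $\tau(u)=1$, and a trace is *pure* if its normalization at some order unit $u$ is an extreme point of $S(G,u)$. A dimension group $G$ with an order unit is *approximately divisible* if $\sigma(G)$ is non-discrete in $\mathbf R$ for every pure trace $\sigma$ of $G$. A trace $\tau$ is *good* if for all $a,b\in G^+\setminus\{0\}$ with $\tau(a)<\tau(b)$ there is $c\in G^+$ with $c\le b$ and $\tau(c)=\tau(a)$; it is *order unit good* if this holds whenever $b$ is in addition an order unit. The *ordered tensor product* $G\otimes H$ is the tensor product over $\mathbf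 Z$ with positive cone consisting of the finite sums of elements $g\otimes h$, $g\in G^+$, $h\in H^+$; $\sigma\otimes\tau$ denotes the homomorphism $G\otimes H\to\mathbf R$ with $(\sigma\otimes\tau)(g\otimes h)=\sigma(g)\tau(h)$. **Proposition 5.2.** Let $G$ and $H$ be approximately divisible dimension groups with order units, and let $\sigma$ and $\tau$ be pure traces of $G$ and $H$ respectively. Then $\sigma\otimes\tau$ is a pure trace of the ordered tensor product $G\otimes H$, and if $\sigma$ and $\tau$ are order unit good, then $\sigma\otimes\tau$ is order unit good. In particular, if moreover $G$ and $H$ are simple and $\sigma$ and $\tau$ are both good, then $\sigma\otimes\tau$ is good. -/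

import Mathlib

open scoped TensorProduct

namespace DimGroup

section Basic

variable {G : Type*} [AddCommGroup G] [Preorder G]

/-- `u` is an order unit: `u` is positive and every `g` satisfies `-N u ≤ g ≤ N u` for some
positive integer `N`. -/
def IsOrderUnit (u : G) : Prop :=
  0 ≤ u ∧ ∀ g : G, ∃ N : ℕ, 0 < N ∧ -(N • u) ≤ g ∧ g ≤ N • u

/-- A trace is a nonzero positive group homomorphism to the reals. -/
def IsTrace (τ : G →+ ℝ) : Prop :=
  τ ≠ 0 ∧ ∀ g : G, 0 ≤ g → 0 ≤ τ g

variable (G) in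
/-- The set `S(G, u)` of traces normalized at `u`, a convex subset of the real vector space of
additive maps from `G` to the reals. -/
def normalizedTraces (u : G) : Set (G →+ ℝ) :=
  {τ | IsTrace τ ∧ τ u = 1}

/-- A trace is pure if, normalized at an order unit `u`, it is an extreme point of `S(G, u)`. -/
def IsPureTrace (τ : G →+ ℝ) : Prop :=
  IsTrace τ ∧ ∃ u : G, IsOrderUnit u ∧ (τ u)⁻¹ • τ ∈ (normalizedTraces G u).extremePoints ℝ

/-- The trace `τ` is good: for all nonzero positive `a`, `b` with `τ a < τ b` there is
`0 ≤ c ≤ b` with `τ c = τ a`. -/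
def IsGood (τ : G →+ ℝ) : Prop :=
  ∀ a b : G, 0 ≤ a → a ≠ 0 → 0 ≤ b → b ≠ 0 → τ a < τ b →
    ∃ c : G, 0 ≤ c ∧ c ≤ b ∧ τ c = τ a

/-- The trace `τ` is order unit good: the condition for being good, with `b` restricted to order
units. -/
def IsOrderUnitGood (τ : G →+ ℝ) : Prop :=
  ∀ a b : G, 0 ≤ a → a ≠ 0 → IsOrderUnit b → τ a < τ b →
    ∃ c : G, 0 ≤ c ∧ c ≤ b ∧ τ c = τ a

variable (G)

/-- The group has an order unit and the image of every pure trace is a non-discrete subgroup of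
the real line. -/
def IsApproximatelyDivisible : Prop :=
  (∃ u : G, IsOrderUnit u) ∧ ∀ σ : G →+ ℝ, IsPureTrace σ → ¬ DiscreteTopology σ.range

/-- Every nonzero positive element is an order unit. -/
def IsSimple : Prop :=
  ∀ g : G, 0 ≤ g → g ≠ 0 → IsOrderUnit g

end Basic

/-- A dimension group: a (directed) partially ordered abelian group that is unperforated and has
the Riesz decomposition property. -/
structure IsDimensionGroup (G : Type*) [AddCommGroup G] [PartialOrder G] [IsOrderedAddMonoid G] :
    Prop where
  directed : ∀ g : G, ∃ p q : G, 0 ≤ p ∧ 0 ≤ q ∧ g = p - q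
  riesz : ∀ a b c : G, 0 ≤ a → 0 ≤ b → 0 ≤ c → a ≤ b + c →
    ∃ b' c' : G, 0 ≤ b' ∧ b' ≤ b ∧ 0 ≤ c' ∧ c' ≤ c ∧ a = b' + c'
  unperforated : ∀ (n : ℕ) (g : G), 0 < n → 0 ≤ n • g → 0 ≤ g

section Tensor

variable (G H : Type*) [AddCommGroup G] [Preorder G] [AddCommGroup H] [Preorder H]

/-- The positive cone of the ordered tensor product: finite sums of tensors `g ⊗ h` with `g` and
`h` positive. -/
def tensorCone : AddSubmonoid (G ⊗[ℤ] H) :=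
  AddSubmonoid.closure {z | ∃ (g : G) (h : H), 0 ≤ g ∧ 0 ≤ h ∧ z = g ⊗ₜ[ℤ] h}

/-- The ordering of the ordered tensor product: `x ≤ y` iff `y - x` lies in the cone generated by
the tensors of positive elements. -/
instance tensorPreorder : Preorder (G ⊗[ℤ] H) where
  le x y := y - x ∈ tensorCone G H
  le_refl x := by
    rw [sub_self]
    exact (tensorCone G H).zero_mem
  le_trans x y z hxy hyz := by
    have h := (tensorCone G H).add_mem hyz hxy
    rwa [sub_add_sub_cancel] at h

instance tensorIsOrderedAddMonoid : IsOrderedAddMonoid (G ⊗[ℤ] H) where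
  add_le_add_left x y hxy z := by
    change (y + z) - (x + z) ∈ tensorCone G H
    rw [add_sub_add_right_eq_sub]
    exact hxy

end Tensor

section TensorTrace

variable {G H : Type*} [AddCommGroup G] [AddCommGroup H]

/-- The additive map `σ ⊗ τ` on the tensor product with `(σ ⊗ τ)(g ⊗ h) = σ g * τ h`. -/
noncomputable def tensorTrace (σ : G →+ ℝ) (τ : H →+ ℝ) : G ⊗[ℤ] H →+ ℝ :=
  (LinearMap.mul' ℤ ℝ ∘ₗ
    TensorProduct.map σ.toIntLinearMap τ.toIntLinearMap).toAddMonoidHom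

theorem tensorTrace_tmul (σ : G →+ ℝ) (τ : H →+ ℝ) (g : G) (h : H) :
    tensorTrace σ τ (g ⊗ₜ[ℤ] h) = σ g * τ h := by
  simp [tensorTrace]

end TensorTrace

end DimGroup

/-! Purity. If ρ is a positive map on `G ⊗ H` below a multiple of σ ⊗ τ, then for fixed h ≥ 0 the
slice g ↦ ρ(g ⊗ h) lies below a multiple of σ. Extremality makes it a multiple of σ. The same
argument in the other variable gives ρ = ρ(u ⊗ v) · σ ⊗ τ (`tensorTrace_mem_extremePoints`).

Goodness. Let ρ = σ ⊗ τ, with b an order unit and 0 < ρ(a) < ρ(b), and put r = ρ(a)/ρ(b). It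
suffices to find c with ρ(c) = ρ(a) such that θ(c) is close to r θ(b), uniformly over normalized
traces θ. Then 0 < θ(c) < θ(b) for all θ, which forces 0 ≤ c ≤ b because `G ⊗ H` is unperforated
(`tensor_unperforated`, `IsOrderUnit.nonneg_of_forall_pos`). Approximate divisibility supplies b'
uniformly close to r b (`tensor_exists_approx_smul`). Order unit goodness of the factors supplies a
correction d with ρ(d) = ρ(a - b') exactly and θ(d) uniformly small (`tensor_exists_approx_const`);
then c = b' + d.

Two tools support this. Relations among positive elements of a dimension group can be lifted to a
simplicial group (`IsDimensionGroup.exists_factorization`). This yields unperforation of the tensor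
product and makes the solutions y of N y ≤ x upward directed. A Hahn–Banach theorem for abelian
groups, together with a compactness argument for directed families, then turns non-discreteness at
each pure trace into approximation uniform over all traces (`IsDimensionGroup.exists_nsmul_le`).

In the simple case every nonzero positive tensor is an order unit, so good and order unit good
coincide. -/

open scoped TensorProduct

namespace DimGroup

/-! ### Hahn–Banach for abelian groups -/

section HahnBanach

variable {K : Type*} [AddCommGroup K]

/-- A subadditive real function on an abelian group that is homogeneous for natural multiples. -/
structure IsSublinear (p : K → ℝ) : Prop where
  add_le : ∀ x y, p (x + y) ≤ p x + p y
  map_nsmul : ∀ (n : ℕ) (x : K), p (n • x) = n * p x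

theorem IsSublinear.neg_le {p : K → ℝ} (hp : IsSublinear p) (x : K) : -p (-x) ≤ p x := by
  have h := hp.add_le x (-x)
  have h0 := hp.map_nsmul 0 0
  simp at h h0
  linarith

/-- The largest sublinear function below `p` whose value at `-g₀` is at most `-p g₀`. -/
noncomputable def shiftInf (p : K → ℝ) (g₀ x : K) : ℝ :=
  ⨅ n : ℕ, (p (x + n • g₀) - n * p g₀)

theorem IsSublinear.neg_le_shift {p : K → ℝ} (hp : IsSublinear p) (g₀ x : K) (n : ℕ) :
    -p (-x) ≤ p (x + n • g₀) - n * p g₀ := by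
  have h := hp.add_le (x + n • g₀) (-x)
  rw [show x + n • g₀ + -x = n • g₀ by abel, hp.map_nsmul] at h
  linarith

theorem IsSublinear.bddBelow_shift {p : K → ℝ} (hp : IsSublinear p) (g₀ x : K) :
    BddBelow (Set.range fun n : ℕ => p (x + n • g₀) - n * p g₀) :=
  ⟨-p (-x), by rintro _ ⟨n, rfl⟩; exact hp.neg_le_shift g₀ x n⟩

theorem IsSublinear.shiftInf_le {p : K → ℝ} (hp : IsSublinear p) (g₀ x : K) (n : ℕ) :
    shiftInf p g₀ x ≤ p (x + n • g₀) - n * p g₀ :=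
  ciInf_le (hp.bddBelow_shift g₀ x) n

theorem IsSublinear.shiftInf {p : K → ℝ} (hp : IsSublinear p) (g₀ : K) :
    IsSublinear (shiftInf p g₀) where
  add_le x y := by
    unfold DimGroup.shiftInf
    refine le_ciInf_add_ciInf fun n m => ?_
    refine (hp.shiftInf_le g₀ (x + y) (n + m)).trans ?_
    have h := hp.add_le (x + n • g₀) (y + m • g₀)
    rw [show x + n • g₀ + (y + m • g₀) = x + y + (n + m) • g₀ by rw [add_nsmul]; abel] at h
    push_cast
    linarith
  map_nsmul k x := by
    rcases Nat.eq_zero_or_pos k with rfl | hk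
    · simp only [zero_smul, Nat.cast_zero, zero_mul]
      apply le_antisymm
      · have := hp.shiftInf_le g₀ 0 0
        have h0 := hp.map_nsmul 0 0
        simp at this h0
        linarith
      · refine le_ciInf fun n => ?_
        rw [zero_add, hp.map_nsmul, sub_self]
    apply le_antisymm
    · unfold DimGroup.shiftInf
      rw [Real.mul_iInf_of_nonneg (Nat.cast_nonneg k)]
      refine le_ciInf fun n => ?_
      refine (hp.shiftInf_le g₀ (k • x) (k * n)).trans ?_
      rw [mul_nsmul', ← smul_add, hp.map_nsmul]
      push_cast
      linarith
    · refine le_ciInf fun n => ?_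
      have h1 := hp.shiftInf_le g₀ x n
      -- The shift on the left is k n after scaling; the excess (k n - n) • g₀ is split off and
      -- costs exactly its own value under `p`.
      have h2 : (k : ℝ) * p (x + n • g₀) = p (k • x + n • g₀ + (k * n - n) • g₀) := by
        rw [← hp.map_nsmul, smul_add, ← mul_nsmul', add_assoc, ← add_nsmul]
        congr 3
        have : n ≤ k * n := Nat.le_mul_of_pos_left n hk
        omega
      have h3 := hp.add_le (k • x + n • g₀) ((k * n - n) • g₀)
      rw [← h2, hp.map_nsmul, Nat.cast_sub (Nat.le_mul_of_pos_left n hk)] at h3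
      have h4 := mul_le_mul_of_nonneg_left h1 (Nat.cast_nonneg (α := ℝ) k)
      push_cast at h3
      linarith

theorem IsSublinear.shiftInf_le_self {p : K → ℝ} (hp : IsSublinear p) (g₀ : K) :
    DimGroup.shiftInf p g₀ ≤ p := fun x => by
  simpa using hp.shiftInf_le g₀ x 0

theorem IsSublinear.shiftInf_neg_le {p : K → ℝ} (hp : IsSublinear p) (g₀ : K) :
    DimGroup.shiftInf p g₀ (-g₀) ≤ -p g₀ := by
  have := hp.shiftInf_le g₀ (-g₀) 1
  have h0 := hp.map_nsmul 0 0
  simp at this h0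
  linarith

/-- Every sublinear function on an abelian group dominates an additive map. -/
theorem IsSublinear.exists_addMonoidHom_le {p : K → ℝ} (hp : IsSublinear p) :
    ∃ φ : K →+ ℝ, ∀ x, φ x ≤ p x := by
  -- In the dual order a maximal element is a pointwise minimal sublinear function, and chains are
  -- bounded by pointwise infima.
  let S : Set (K → ℝ)ᵒᵈ := {q | IsSublinear (OrderDual.ofDual q)}
  obtain ⟨m, hpm, hm⟩ := zorn_le_nonempty₀ S (by
    intro c hcS hc y hy
    have : Nonempty c := ⟨⟨y, hy⟩⟩
    have hb : ∀ x, BddBelow (Set.range fun q : c => OrderDual.ofDual q.1 x) := by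
      intro x
      refine ⟨-(OrderDual.ofDual y (-x)) - |OrderDual.ofDual y x|, ?_⟩
      rintro _ ⟨q, rfl⟩
      have hq := (hcS q.2).neg_le x
      have hyx := (hcS hy).neg_le x
      have h1 := neg_abs_le (OrderDual.ofDual y x)
      have h2 := le_abs_self (OrderDual.ofDual y x)
      rcases hc.total q.2 hy with h | h
      · have := h x
        change OrderDual.ofDual y x ≤ OrderDual.ofDual q.1 x at this
        change _ ≤ OrderDual.ofDual q.1 x
        linarith [abs_nonneg (OrderDual.ofDual y x)]
      · have := h (-x)
        change OrderDual.ofDual q.1 (-x) ≤ OrderDual.ofDual y (-x) at this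
        change _ ≤ OrderDual.ofDual q.1 x
        linarith [abs_nonneg (OrderDual.ofDual y x)]
    refine ⟨OrderDual.toDual fun x => ⨅ q : c, OrderDual.ofDual q.1 x, ⟨?_, ?_⟩, ?_⟩
    · intro x z
      refine le_ciInf_add_ciInf fun q r => ?_
      rcases hc.total q.2 r.2 with h | h
      · refine (ciInf_le (hb (x + z)) r).trans (((hcS r.2).add_le x z).trans ?_)
        have : OrderDual.ofDual r.1 x ≤ OrderDual.ofDual q.1 x := h x
        linarith
      · refine (ciInf_le (hb (x + z)) q).trans (((hcS q.2).add_le x z).trans ?_)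
        have : OrderDual.ofDual q.1 z ≤ OrderDual.ofDual r.1 z := h z
        linarith
    · intro n x
      change (⨅ q : c, OrderDual.ofDual q.1 (n • x)) = n * ⨅ q : c, OrderDual.ofDual q.1 x
      rw [Real.mul_iInf_of_nonneg (Nat.cast_nonneg n)]
      exact iInf_congr fun q => (hcS q.2).map_nsmul n x
    · intro q hq x
      exact ciInf_le (hb x) ⟨q, hq⟩) (OrderDual.toDual p) hp
  set q : K → ℝ := OrderDual.ofDual m with hqdef
  have hq : IsSublinear q := hm.1
  have hneg : ∀ x, q (-x) = -q x := by
    intro x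
    have h1 := hq.shiftInf_neg_le x
    -- Minimality of `q` against its own shift forces q(-x) ≤ -q(x), so `q` is odd; an odd
    -- subadditive function is additive.
    have h2 : q ≤ DimGroup.shiftInf q x :=
      hm.2 (y := OrderDual.toDual (DimGroup.shiftInf q x)) (hq.shiftInf x)
        (hq.shiftInf_le_self x)
    have h3 := hq.neg_le x
    have h4 := h2 (-x)
    linarith
  refine ⟨AddMonoidHom.mk' q fun x y => le_antisymm (hq.add_le x y) ?_, fun x => hpm x⟩
  have h := hq.add_le (x + y) (-y)
  rw [add_neg_cancel_right, hneg] at h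
  linarith

/-- The additive map in the Hahn–Banach theorem can be made to touch `p` at a given point. -/
theorem IsSublinear.exists_addMonoidHom_le_eq {p : K → ℝ} (hp : IsSublinear p) (g₀ : K) :
    ∃ φ : K →+ ℝ, (∀ x, φ x ≤ p x) ∧ φ g₀ = p g₀ := by
  obtain ⟨φ, hφ⟩ := (hp.shiftInf g₀).exists_addMonoidHom_le
  have h : ∀ x, φ x ≤ p x := fun x => (hφ x).trans (hp.shiftInf_le_self g₀ x)
  refine ⟨φ, h, le_antisymm (h g₀) ?_⟩
  have h1 := (hφ (-g₀)).trans (hp.shiftInf_neg_le g₀)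
  rw [map_neg] at h1
  linarith

end HahnBanach

/-! ### Lifting relations to simplicial groups -/

section Factorization

theorem sum_zsmul_sum_nsmul {G : Type*} [AddCommGroup G]
    {ι κ : Type*} [Fintype ι] [Fintype κ] (n : ι → ℤ) (A : ι → κ → ℕ)
    (f : κ → G) :
    ∑ i, n i • ∑ l, A i l • f l = ∑ l, (∑ i, n i * A i l) • f l := by
  simp_rw [Finset.smul_sum, Finset.sum_smul]
  rw [Finset.sum_comm]
  refine Finset.sum_congr rfl fun l _ => Finset.sum_congr rfl fun i _ => ?_
  rw [mul_smul, natCast_zsmul]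

variable {G : Type*} [AddCommGroup G] [PartialOrder G] [IsOrderedAddMonoid G]

/-- Riesz decomposition iterated over a finite sum. Setting `h` to zero off `s` lets later sums run
over the whole index type. -/
theorem IsDimensionGroup.exists_sum_of_le_sum (hG : IsDimensionGroup G) {ι : Type*} (s : Finset ι)
    (b : ι → G) (hb : ∀ i, 0 ≤ b i) (a : G) (ha : 0 ≤ a) (hab : a ≤ ∑ i ∈ s, b i) :
    ∃ h : ι → G, (∀ i, 0 ≤ h i ∧ h i ≤ b i) ∧ (∀ i ∉ s, h i = 0) ∧ a = ∑ i ∈ s, h i := by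
  classical
  induction s using Finset.induction_on generalizing a with
  | empty =>
    refine ⟨0, fun i => ⟨le_rfl, hb i⟩, fun _ _ => rfl, ?_⟩
    simpa using le_antisymm (by simpa using hab) ha
  | insert j s hj ih =>
    rw [Finset.sum_insert hj] at hab
    obtain ⟨b', c', hb0, hbb, hc0, hcc, rfl⟩ :=
      hG.riesz a (b j) (∑ i ∈ s, b i) ha (hb j) (Finset.sum_nonneg fun i _ => hb i) hab
    obtain ⟨h, h1, h2, rfl⟩ := ih c' hc0 hcc
    refine ⟨Function.update h j b', fun i => ?_, fun i hi => ?_, ?_⟩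
    · rcases eq_or_ne i j with rfl | hij
      · simpa using ⟨hb0, hbb⟩
      · simpa [hij] using h1 i
    · rw [Finset.mem_insert, not_or] at hi
      simpa [hi.1] using h2 i hi.2
    · rw [Finset.sum_insert hj, Function.update_self]
      congr 1
      refine Finset.sum_congr rfl fun i hi => ?_
      rw [Function.update_of_ne]
      rintro rfl
      exact hj hi

/-- One refinement step: a relation among positive elements, one of whose coefficients is
positive and of maximal size, is the push-forward of a relation with fewer coefficients of that
size. -/
theorem IsDimensionGroup.exists_refinement (hG : IsDimensionGroup G) {ι : Type} [Fintype ι]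
    (e : ι → G) (he : ∀ i, 0 ≤ e i) (n : ι → ℤ) (hn : ∑ i, n i • e i = 0) (N : ℕ) (hN : 0 < N)
    (hnN : ∀ i, (n i).natAbs ≤ N) (i₀ : ι) (hi₀ : n i₀ = N) :
    ∃ (e' : ι ⊕ ι → G) (B : ι → ι ⊕ ι → ℕ), (∀ x, 0 ≤ e' x) ∧ (∀ i, e i = ∑ x, B i x • e' x) ∧
      (∀ x, (∑ i, n i * B i x).natAbs ≤ N) ∧
      (Finset.univ.filter fun x => (∑ i, n i * (B i x : ℤ)).natAbs = N).card <
        (Finset.univ.filter fun i => (n i).natAbs = N).card := by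
  classical
  -- Adding the relation to N times the difference leaves coefficients 0 at i₀, n i + N ≥ 0 where n
  -- i < 0, and n i ≥ 0 elsewhere. Unperforation then removes the factor N.
  have key : e i₀ ≤ ∑ i ∈ Finset.univ.filter (fun i => n i < 0), e i := by
    rw [← sub_nonneg]
    refine hG.unperforated N _ hN ?_
    have : N • (∑ i ∈ Finset.univ.filter (fun i => n i < 0), e i - e i₀) =
        ∑ i, ((if n i < 0 then (N : ℤ) else 0) - (if i = i₀ then (N : ℤ) else 0) + n i) • e i := by
      simp only [add_smul, sub_smul, Finset.sum_add_distrib, Finset.sum_sub_distrib, hn, ite_smul,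
        zero_smul, add_zero, Finset.sum_ite_eq', Finset.mem_univ, if_true, smul_sub,
        Finset.smul_sum, natCast_zsmul, Finset.sum_filter, smul_ite, smul_zero]
    rw [this]
    refine Finset.sum_nonneg fun i _ => ?_
    have hi := hnN i
    refine zsmul_nonneg (he i) ?_
    by_cases h1 : i = i₀
    · subst h1
      rw [if_neg (by omega), if_pos rfl]
      omega
    · rw [if_neg h1]
      split_ifs <;> omega
  obtain ⟨h, h1, h2, h3⟩ := hG.exists_sum_of_le_sum _ e he _ (he i₀) key
  -- The new generators are e i - h i and h i, with e i₀ rewritten as the sum of the h k. The first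
  -- kind keeps the coefficient n k (0 at i₀); the second gets n k + N, in [0, N), when n k < 0 and
  -- 0 otherwise. So i₀ is lost from the coefficients of size N and none is gained.
  refine ⟨Sum.elim (fun i => e i - h i) h,
    fun i => Sum.elim (fun k => if i = k ∧ k ≠ i₀ then 1 else 0)
      (fun k => if n k < 0 ∧ (i = k ∨ i = i₀) then 1 else 0), ?_, ?_, ?_⟩
  · rintro (i | i)
    · exact sub_nonneg.2 (h1 i).2
    · exact (h1 i).1
  · intro i
    rw [Fintype.sum_sum_type]
    simp only [Sum.elim_inl, Sum.elim_inr, ite_smul, one_smul, zero_smul]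
    by_cases hi : i = i₀
    · subst hi
      rw [Finset.sum_eq_zero, zero_add]
      · rw [h3, Finset.sum_filter]
        refine Finset.sum_congr rfl fun k _ => ?_
        simp
      · intro k _
        rw [if_neg]
        rintro ⟨rfl, h⟩
        exact h rfl
    · rw [Finset.sum_eq_single i, Finset.sum_eq_single i]
      · rw [if_pos ⟨rfl, hi⟩]
        split_ifs with h4
        · abel
        · rw [h2 i (by simpa using h4)]
          abel
      · intro k _ hk
        rw [if_neg]
        rintro ⟨_, rfl | h⟩
        · exact hk rfl
        · exact hi h
      · simp
      · intro k _ hk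
        rw [if_neg]
        rintro ⟨rfl, _⟩
        exact hk rfl
      · simp
  have hl : ∀ k, (∑ i, n i * ((if i = k ∧ k ≠ i₀ then 1 else 0 : ℕ) : ℤ)) =
      if k = i₀ then 0 else n k := by
    intro k
    rw [Finset.sum_eq_single k]
    · by_cases hk : k = i₀ <;> simp [hk]
    · intro i _ hi
      simp [hi]
    · simp
  have hr : ∀ k, (∑ i, n i * ((if n k < 0 ∧ (i = k ∨ i = i₀) then 1 else 0 : ℕ) : ℤ)) =
      if n k < 0 then n k + N else 0 := by
    intro k
    split_ifs with hk
    · have hne : k ≠ i₀ := by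
        rintro rfl
        omega
      rw [← hi₀, ← Finset.sum_pair hne, ← Finset.sum_filter_add_sum_filter_not Finset.univ
        (fun i => i ∈ ({k, i₀} : Finset ι))]
      rw [Finset.sum_eq_zero (s := Finset.univ.filter (fun i => i ∉ ({k, i₀} : Finset ι))),
        add_zero]
      · have : Finset.univ.filter (fun i => i ∈ ({k, i₀} : Finset ι)) = {k, i₀} := by
          ext; simp
        rw [this]
        refine Finset.sum_congr rfl fun i hi => ?_
        rw [Finset.mem_insert, Finset.mem_singleton] at hi
        rw [if_pos ⟨hk, hi⟩]
        simp
      · intro i hi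
        simp only [Finset.mem_filter, Finset.mem_univ, true_and, Finset.mem_insert,
          Finset.mem_singleton] at hi
        simp [hi]
    · simp [hk]
  constructor
  · rintro (k | k)
    · simp only [Sum.elim_inl, hl]
      have := hnN k
      split_ifs <;> omega
    · simp only [Sum.elim_inr, hr]
      have := hnN k
      split_ifs <;> omega
  · refine lt_of_le_of_lt (Finset.card_le_card (t := ((Finset.univ.filter
      fun i => (n i).natAbs = N).erase i₀).map Function.Embedding.inl) ?_) ?_
    · rintro (k | k) hk
      · simp only [Finset.mem_filter, Finset.mem_univ, true_and, Sum.elim_inl, hl] at hk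
        have hk0 : k ≠ i₀ := by
          rintro rfl
          simp at hk
          omega
        rw [if_neg hk0] at hk
        simp [hk0, hk]
      · simp only [Finset.mem_filter, Finset.mem_univ, true_and, Sum.elim_inr, hr] at hk
        have := hnN k
        split_ifs at hk <;> omega
    · rw [Finset.card_map]
      exact Finset.card_erase_lt_of_mem (by simp [hi₀])

/-- An integer relation among positive elements of a dimension group is the image of a relation
in a simplicial group. -/
theorem IsDimensionGroup.exists_factorization_of_relation (hG : IsDimensionGroup G)
    {ι : Type} [Fintype ι] (e : ι → G) (he : ∀ i, 0 ≤ e i) (n : ι → ℤ)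
    (hn : ∑ i, n i • e i = 0) :
    ∃ (κ : Type) (_ : Fintype κ) (f : κ → G) (A : ι → κ → ℕ), (∀ l, 0 ≤ f l) ∧
      (∀ i, e i = ∑ l, A i l • f l) ∧ ∀ l, ∑ i, n i * (A i l : ℤ) = 0 := by
  obtain ⟨N, hN⟩ : ∃ N : ℕ, ∀ i, (n i).natAbs ≤ N :=
    ⟨∑ i, (n i).natAbs, fun i =>
      Finset.single_le_sum (f := fun i => (n i).natAbs) (fun _ _ => Nat.zero_le _)
        (Finset.mem_univ i)⟩
  -- Lexicographic induction on the bound for the coefficients and the number of coefficients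
  -- attaining it.
  induction N generalizing ι with
  | zero =>
    classical
    refine ⟨ι, inferInstance, e, fun i l => if i = l then 1 else 0, he, fun i => by simp, ?_⟩
    intro l
    refine Finset.sum_eq_zero fun i _ => ?_
    have := hN i
    rw [show n i = 0 by omega, zero_mul]
  | succ N ih =>
    obtain ⟨c, hc⟩ : ∃ c, (Finset.univ.filter fun i => (n i).natAbs = N + 1).card = c := ⟨_, rfl⟩
    induction c using Nat.strong_induction_on generalizing ι with
    | _ c ihc =>
    by_cases h : ∀ i, (n i).natAbs ≤ N
    · exact ih e he n hn h
    push Not at h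
    obtain ⟨i₀, hi₀⟩ := h
    have hi₀' : (n i₀).natAbs = N + 1 := le_antisymm (hN i₀) hi₀
    obtain ⟨s, hs, hsn⟩ : ∃ s : ℤ, (s = 1 ∨ s = -1) ∧ s * n i₀ = (N + 1 : ℕ) := by
      rcases Int.natAbs_eq (n i₀) with h | h
      · exact ⟨1, Or.inl rfl, by omega⟩
      · exact ⟨-1, Or.inr rfl, by omega⟩
    have habs : ∀ z : ℤ, (s * z).natAbs = z.natAbs := by
      intro z
      rcases hs with rfl | rfl <;> simp
    obtain ⟨e', B, he', hB, hle, hcard⟩ := hG.exists_refinement e he (fun i => s * n i)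
      (by simp_rw [mul_smul, ← Finset.smul_sum, hn, smul_zero]) (N + 1) (Nat.succ_pos N)
      (fun i => by rw [habs]; exact hN i) i₀ hsn
    simp_rw [mul_assoc, ← Finset.mul_sum, habs] at hle hcard
    rw [hc] at hcard
    have hrel : ∑ x, (∑ i, n i * (B i x : ℤ)) • e' x = 0 := by
      rw [← sum_zsmul_sum_nsmul, ← hn]
      exact Finset.sum_congr rfl fun i _ => by rw [← hB i]
    obtain ⟨κ, hκ, f, A, hf, hA, hz⟩ := ihc _ hcard e' he' _ hrel hle rfl
    refine ⟨κ, hκ, f, fun i l => ∑ x, B i x * A x l, hf, fun i => ?_, fun l => ?_⟩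
    · rw [hB i]
      simp_rw [Finset.sum_smul]
      rw [Finset.sum_comm]
      refine Finset.sum_congr rfl fun x _ => ?_
      rw [hA x, Finset.smul_sum]
      exact Finset.sum_congr rfl fun l _ => by rw [mul_smul]
    · rw [← hz l]
      push_cast
      simp_rw [Finset.mul_sum, Finset.sum_mul]
      rw [Finset.sum_comm]
      simp_rw [mul_assoc]

/-- Finitely many integer relations among positive elements of a dimension group are the image
of relations in a simplicial group. -/
theorem IsDimensionGroup.exists_factorization (hG : IsDimensionGroup G)
    {ι : Type} [Fintype ι] (e : ι → G) (he : ∀ i, 0 ≤ e i) (k : ℕ) (n : ι → Fin k → ℤ)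
    (hn : ∀ j, ∑ i, n i j • e i = 0) :
    ∃ (κ : Type) (_ : Fintype κ) (f : κ → G) (A : ι → κ → ℕ), (∀ l, 0 ≤ f l) ∧
      (∀ i, e i = ∑ l, A i l • f l) ∧ ∀ j l, ∑ i, n i j * (A i l : ℤ) = 0 := by
  induction k with
  | zero =>
    classical
    exact ⟨ι, inferInstance, e, fun i l => if i = l then 1 else 0, he, fun i => by simp,
      fun j => j.elim0⟩
  | succ k ih =>
    obtain ⟨κ, hκ, f, A, hf, hA, hz⟩ := ih (fun i j => n i j.castSucc) fun j => hn j.castSucc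
    have hrel : ∑ x, (∑ i, n i (Fin.last k) * (A i x : ℤ)) • f x = 0 := by
      rw [← sum_zsmul_sum_nsmul, ← hn (Fin.last k)]
      exact Finset.sum_congr rfl fun i _ => by rw [← hA i]
    obtain ⟨κ', hκ', f', A', hf', hA', hz'⟩ := hG.exists_factorization_of_relation f hf _ hrel
    have hcomp : ∀ j l, ∑ i, n i j * ((∑ x, A i x * A' x l : ℕ) : ℤ) =
        ∑ x, (∑ i, n i j * (A i x : ℤ)) * A' x l := by
      intro j l
      push_cast
      simp_rw [Finset.mul_sum, Finset.sum_mul]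
      rw [Finset.sum_comm]
      simp_rw [mul_assoc]
    refine ⟨κ', hκ', f', fun i l => ∑ x, A i x * A' x l, hf', fun i => ?_, fun j l => ?_⟩
    · rw [hA i]
      simp_rw [Finset.sum_smul]
      rw [Finset.sum_comm]
      refine Finset.sum_congr rfl fun x _ => ?_
      rw [hA' x, Finset.smul_sum]
      exact Finset.sum_congr rfl fun l _ => by rw [mul_smul]
    · rw [hcomp]
      -- Relations already killed by `A` stay killed after composing with `A'`; only the last one
      -- uses the new factorization.
      induction j using Fin.lastCases with
      | last => exact hz' l
      | cast j => exact Finset.sum_eq_zero fun x _ => by rw [hz j x, zero_mul]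

end Factorization

/-! ### Directedness of the solutions of N • y ≤ x -/

section Divisibility

variable {G : Type*} [AddCommGroup G] [PartialOrder G] [IsOrderedAddMonoid G]

/-- In a dimension group, two lower bounds for `x` of the form `N • a` lie below a third one. -/
theorem IsDimensionGroup.exists_ge_ge_nsmul_le (hG : IsDimensionGroup G) (N : ℕ) (a b x : G)
    (ha : N • a ≤ x) (hb : N • b ≤ x) : ∃ c, a ≤ c ∧ b ≤ c ∧ N • c ≤ x := by
  obtain ⟨a₁, a₂, ha₁, ha₂, rfl⟩ := hG.directed a
  obtain ⟨b₁, b₂, hb₁, hb₂, rfl⟩ := hG.directed b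
  obtain ⟨x₁, x₂, hx₁, hx₂, rfl⟩ := hG.directed x
  -- The positive parts of a, b, x and the slacks x - N a, x - N b are lifted together with the two
  -- relations defining the slacks. In the simplicial group both inequalities hold coordinatewise,
  -- so the coordinatewise maximum of a and b serves as c.
  obtain ⟨κ, _, f, A, hf, hA, hz⟩ := hG.exists_factorization
    (ι := Fin 8) ![a₁, a₂, b₁, b₂, x₁, x₂, x₁ - x₂ - N • (a₁ - a₂), x₁ - x₂ - N • (b₁ - b₂)]
    (by
      intro i
      fin_cases i
      exacts [ha₁, ha₂, hb₁, hb₂, hx₁, hx₂, sub_nonneg.2 ha, sub_nonneg.2 hb])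
    2 (fun i j => (![![(N : ℤ), -N, 0, 0, -1, 1, 1, 0], ![0, 0, N, -N, -1, 1, 0, 1]] j) i)
    (by
      intro j
      fin_cases j
      · simp [Fin.sum_univ_succ, smul_sub]
        abel
      · simp [Fin.sum_univ_succ, smul_sub]
        abel)
  have r1 : ∀ l, (A 6 l : ℤ) = A 4 l - A 5 l - N * (A 0 l - A 1 l) := by
    intro l
    have := hz 0 l
    simp [Fin.sum_univ_succ] at this
    linarith!
  have r2 : ∀ l, (A 7 l : ℤ) = A 4 l - A 5 l - N * (A 2 l - A 3 l) := by
    intro l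
    have := hz 1 l
    simp [Fin.sum_univ_succ] at this
    linarith!
  have h0 : a₁ = ∑ l, (A 0 l : ℤ) • f l := by simpa using hA 0
  have h1 : a₂ = ∑ l, (A 1 l : ℤ) • f l := by simpa using hA 1
  have h2 : b₁ = ∑ l, (A 2 l : ℤ) • f l := by simpa using hA 2
  have h3 : b₂ = ∑ l, (A 3 l : ℤ) • f l := by simpa using hA 3
  have h4 : x₁ = ∑ l, (A 4 l : ℤ) • f l := by simpa using hA 4
  have h5 : x₂ = ∑ l, (A 5 l : ℤ) • f l := by simpa using hA 5
  refine ⟨∑ l, max ((A 0 l : ℤ) - A 1 l) ((A 2 l : ℤ) - A 3 l) • f l, ?_, ?_, ?_⟩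
  · rw [h0, h1, ← Finset.sum_sub_distrib]
    refine Finset.sum_le_sum fun l _ => ?_
    rw [← sub_smul]
    exact zsmul_le_zsmul_left (hf l) (le_max_left _ _)
  · rw [h2, h3, ← Finset.sum_sub_distrib]
    refine Finset.sum_le_sum fun l _ => ?_
    rw [← sub_smul]
    exact zsmul_le_zsmul_left (hf l) (le_max_right _ _)
  · rw [h4, h5, ← Finset.sum_sub_distrib, Finset.smul_sum]
    refine Finset.sum_le_sum fun l _ => ?_
    rw [← sub_smul, ← natCast_zsmul, ← mul_smul]
    refine zsmul_le_zsmul_left (hf l) ?_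
    rw [mul_max_of_nonneg _ _ (Int.natCast_nonneg N)]
    have := r1 l
    have := r2 l
    refine max_le ?_ ?_ <;> omega

end Divisibility

/-! ### The tensor cone and its unperforation -/

section TensorCone

theorem tensor_nonneg_iff {G H : Type*} [AddCommGroup G] [Preorder G] [AddCommGroup H]
    [Preorder H] {z : G ⊗[ℤ] H} : 0 ≤ z ↔ z ∈ tensorCone G H := by
  change z - 0 ∈ tensorCone G H ↔ _
  rw [sub_zero]

theorem tmul_nonneg {G H : Type*} [AddCommGroup G] [Preorder G] [AddCommGroup H]
    [Preorder H] {g : G} {h : H} (hg : 0 ≤ g) (hh : 0 ≤ h) : 0 ≤ g ⊗ₜ[ℤ] h :=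
  tensor_nonneg_iff.2 (AddSubmonoid.subset_closure ⟨g, h, hg, hh, rfl⟩)

theorem exists_sum_tmul_of_nonneg {G H : Type*} [AddCommGroup G] [Preorder G] [AddCommGroup H]
    [Preorder H] {z : G ⊗[ℤ] H} (hz : 0 ≤ z) :
    ∃ (ι : Type) (_ : Fintype ι) (g : ι → G) (h : ι → H), (∀ i, 0 ≤ g i) ∧ (∀ i, 0 ≤ h i) ∧
      z = ∑ i, g i ⊗ₜ[ℤ] h i := by
  rw [tensor_nonneg_iff] at hz
  induction hz using AddSubmonoid.closure_induction with
  | mem z hz =>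
    obtain ⟨g, h, hg, hh, rfl⟩ := hz
    exact ⟨Unit, inferInstance, fun _ => g, fun _ => h, fun _ => hg, fun _ => hh, by simp⟩
  | zero => exact ⟨Empty, inferInstance, Empty.elim, Empty.elim, by simp, by simp, by simp⟩
  | add x y _ _ hx hy =>
    obtain ⟨ι, _, g, h, hg, hh, rfl⟩ := hx
    obtain ⟨ι', _, g', h', hg', hh', rfl⟩ := hy
    exact ⟨ι ⊕ ι', inferInstance, Sum.elim g g', Sum.elim h h', by simpa using ⟨hg, hg'⟩,
      by simpa using ⟨hh, hh'⟩, by simp⟩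

variable {G : Type*} [AddCommGroup G] [PartialOrder G] [IsOrderedAddMonoid G]
variable {H : Type*} [AddCommGroup H] [PartialOrder H] [IsOrderedAddMonoid H]

theorem IsDimensionGroup.exists_sum_tmul {H : Type*} [AddCommGroup H]
    (hG : IsDimensionGroup G) (z : G ⊗[ℤ] H) :
    ∃ (ι : Type) (_ : Fintype ι) (g : ι → G) (h : ι → H), (∀ i, 0 ≤ g i) ∧
      z = ∑ i, g i ⊗ₜ[ℤ] h i := by
  induction z using TensorProduct.induction_on with
  | zero => exact ⟨Empty, inferInstance, Empty.elim, Empty.elim, by simp, by simp⟩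
  | tmul g h =>
    obtain ⟨p, q, hp, hq, rfl⟩ := hG.directed g
    exact ⟨Unit ⊕ Unit, inferInstance, Sum.elim (fun _ => p) (fun _ => q),
      Sum.elim (fun _ => h) (fun _ => -h), by simpa using ⟨hp, hq⟩,
      by simp [TensorProduct.sub_tmul, TensorProduct.tmul_neg, ← sub_eq_add_neg]⟩
  | add x y hx hy =>
    obtain ⟨ι, _, g, h, hg, rfl⟩ := hx
    obtain ⟨ι', _, g', h', hg', rfl⟩ := hy
    exact ⟨ι ⊕ ι', inferInstance, Sum.elim g g', Sum.elim h h', by simpa using ⟨hg, hg'⟩,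
      by simp⟩

/-- Over ℤ flat means torsion-free, and unperforation makes a torsion element both nonnegative and
nonpositive. -/
theorem IsDimensionGroup.flat (hH : IsDimensionGroup H) : Module.Flat ℤ H := by
  rw [IsDedekindDomain.flat_iff_torsion_eq_bot, eq_bot_iff]
  intro x hx
  rw [Submodule.mem_torsion_iff] at hx
  obtain ⟨⟨a, ha⟩, hax⟩ := hx
  have ha0 : a ≠ 0 := nonZeroDivisors.ne_zero ha
  change a • x = 0 at hax
  have hn : a.natAbs • x = 0 := by
    rcases Int.natAbs_eq a with h | h
    · rw [h] at hax
      simpa using hax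
    · rw [h] at hax
      simpa using hax
  have hpos : 0 < a.natAbs := Int.natAbs_pos.2 ha0
  have h1 := hH.unperforated a.natAbs x hpos hn.ge
  have h2 := hH.unperforated a.natAbs (-x) hpos (by rw [smul_neg, hn, neg_zero])
  exact le_antisymm (neg_nonneg.1 h2) h1

/-- The ordered tensor product of dimension groups is unperforated. -/
theorem tensor_unperforated (hG : IsDimensionGroup G) (hH : IsDimensionGroup H) (n : ℕ)
    (z : G ⊗[ℤ] H) (hn : 0 < n) (hz : 0 ≤ n • z) : 0 ≤ z := by
  obtain ⟨I, _, x, y, hx, rfl⟩ := hG.exists_sum_tmul z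
  obtain ⟨J, _, g, h, hg, hh, hgh⟩ := exists_sum_tmul_of_nonneg hz
  have := hH.flat
  have hvan : ∑ i, Sum.elim x g i ⊗ₜ[ℤ] Sum.elim (fun i => n • y i) (fun j => -h j) i = 0 := by
    rw [Fintype.sum_sum_type]
    simp only [Sum.elim_inl, Sum.elim_inr, TensorProduct.tmul_neg, Finset.sum_neg_distrib,
      ← hgh, Finset.smul_sum, TensorProduct.tmul_smul, add_neg_cancel]
  -- By flatness, the equation n z = ∑ g ⊗ h holds because of finitely many integer relations among
  -- the left factors. These are positive in G, so the relations lift to a simplicial group.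
  obtain ⟨k, a, w, hw, ha⟩ :=
    TensorProduct.vanishesTrivially_of_sum_tmul_eq_zero_of_rTensor_injective ℤ
      (Module.Flat.rTensor_preserves_injective_linearMap _ (Submodule.injective_subtype _)) hvan
  obtain ⟨κ, _, f, A, hf, hA, hz⟩ := hG.exists_factorization (Sum.elim x g)
    (by simpa using ⟨hx, hg⟩) k a ha
  have hsum : ∀ l, ∑ i, (A i l : ℤ) • Sum.elim (fun i => n • y i) (fun j => -h j) i = 0 := by
    intro l
    simp_rw [hw, Finset.smul_sum, ← mul_smul]
    rw [Finset.sum_comm]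
    refine Finset.sum_eq_zero fun j _ => ?_
    rw [← Finset.sum_smul, ← zero_smul ℤ (w j), ← hz j l]
    simp_rw [mul_comm]
  -- In coordinate l the equation reads n • Y = (a nonnegative combination of the h j), so
  -- unperforation of H applies to each coefficient of z separately.
  have hY : ∀ l, 0 ≤ ∑ i, A (Sum.inl i) l • y i := by
    intro l
    refine hH.unperforated n _ hn ?_
    have h1 := hsum l
    rw [Fintype.sum_sum_type] at h1
    simp only [Sum.elim_inl, Sum.elim_inr, smul_neg, Finset.sum_neg_distrib, natCast_zsmul] at h1
    rw [add_neg_eq_zero] at h1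
    rw [Finset.smul_sum]
    simp_rw [smul_comm n]
    rw [h1]
    exact Finset.sum_nonneg fun j _ => nsmul_nonneg (hh j) _
  have hfin : ∑ i, x i ⊗ₜ[ℤ] y i = ∑ l, f l ⊗ₜ[ℤ] ∑ i, A (Sum.inl i) l • y i := by
    simp_rw [TensorProduct.tmul_sum]
    rw [Finset.sum_comm]
    refine Finset.sum_congr rfl fun i _ => ?_
    rw [show x i = ∑ l, A (Sum.inl i) l • f l from hA (Sum.inl i), TensorProduct.sum_tmul]
    exact Finset.sum_congr rfl fun l _ => by rw [TensorProduct.smul_tmul]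
  rw [hfin]
  exact Finset.sum_nonneg fun l _ => tmul_nonneg (hf l) (hY l)

end TensorCone

/-! ### Order units, gauges and extreme traces -/

section Traces

variable {K : Type*} [AddCommGroup K] [Preorder K]

theorem mem_normalizedTraces_of_nonneg {w : K} {θ : K →+ ℝ} (h : ∀ g, 0 ≤ g → 0 ≤ θ g)
    (hw : θ w = 1) : θ ∈ normalizedTraces K w := by
  refine ⟨⟨?_, h⟩, hw⟩
  rintro rfl
  simp at hw

variable [IsOrderedAddMonoid K]

theorem monotone_of_nonneg {θ : K →+ ℝ} (h : ∀ g, 0 ≤ g → 0 ≤ θ g) : Monotone θ := by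
  intro x y hxy
  have := h (y - x) (sub_nonneg.2 hxy)
  rw [map_sub] at this
  linarith

theorem IsOrderUnit.exists_bound {u : K} (hu : IsOrderUnit u) (g : K) :
    ∃ N : ℕ, 0 < N ∧ ∀ φ : K →+ ℝ, (∀ g, 0 ≤ g → 0 ≤ φ g) → |φ g| ≤ N * φ u := by
  obtain ⟨N, hN, h1, h2⟩ := hu.2 g
  refine ⟨N, hN, fun φ hφ => abs_le.2 ⟨?_, ?_⟩⟩
  · simpa using monotone_of_nonneg hφ h1
  · simpa using monotone_of_nonneg hφ h2

theorem IsOrderUnit.pos_of_isTrace {u : K} (hu : IsOrderUnit u) {θ : K →+ ℝ} (hθ : IsTrace θ) :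
    0 < θ u := by
  refine lt_of_le_of_ne (hθ.2 u hu.1) fun h => hθ.1 ?_
  ext g
  obtain ⟨N, _, hN⟩ := hu.exists_bound g
  have := hN θ hθ.2
  rw [← h, mul_zero, abs_nonpos_iff] at this
  exact this

theorem IsOrderUnit.mono {u v : K} (hu : IsOrderUnit u) (huv : u ≤ v) : IsOrderUnit v := by
  refine ⟨hu.1.trans huv, fun g => ?_⟩
  obtain ⟨N, hN, h1, h2⟩ := hu.2 g
  have h3 : N • u ≤ N • v := nsmul_le_nsmul_right huv N
  exact ⟨N, hN, (neg_le_neg_iff.2 h3).trans h1, h2.trans h3⟩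

theorem IsOrderUnit.of_le_nsmul {u b : K} (hu : IsOrderUnit u) (hb : 0 ≤ b) (n : ℕ)
    (h : u ≤ n • b) : IsOrderUnit b := by
  refine ⟨hb, fun g => ?_⟩
  obtain ⟨N, hN, h1, h2⟩ := hu.2 g
  have h3 : N • u ≤ (N * n + 1) • b := by
    calc N • u ≤ N • (n • b) := nsmul_le_nsmul_right h N
      _ = (N * n) • b := by rw [mul_nsmul']
      _ ≤ (N * n + 1) • b := nsmul_le_nsmul_left hb (Nat.le_succ _)
  exact ⟨N * n + 1, Nat.succ_pos _, (neg_le_neg_iff.2 h3).trans h1, h2.trans h3⟩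

/-- The upper order-unit gauge `inf {m / n : n • g ≤ m • w}`. -/
noncomputable def gauge (w g : K) : ℝ :=
  ⨅ p : {p : ℤ × ℕ // 0 < p.2 ∧ p.2 • g ≤ p.1 • w}, (p.1.1 : ℝ) / p.1.2

/-- The order is only a preorder here, so w ≤ 0 must be excluded by hand; otherwise the gauge would
be unbounded below. -/
theorem IsOrderUnit.zsmul_nonneg_iff {w : K} (hw : IsOrderUnit w) (h0 : ¬ w ≤ 0) {m : ℤ}
    (hm : 0 ≤ m • w) : 0 ≤ m := by
  by_contra hneg
  push Not at hneg
  apply h0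
  obtain ⟨k, hk⟩ : ∃ k : ℕ, m = -(k + 1 : ℕ) := ⟨(-m - 1).toNat, by omega⟩
  rw [hk, neg_smul, natCast_zsmul, neg_nonneg] at hm
  calc w ≤ (k + 1) • w := by
        simpa using nsmul_le_nsmul_left hw.1 (Nat.le_add_left 1 k)
    _ ≤ 0 := hm

theorem IsOrderUnit.bddBelow_gauge {w : K} (hw : IsOrderUnit w) (h0 : ¬ w ≤ 0) (g : K) :
    BddBelow (Set.range fun p : {p : ℤ × ℕ // 0 < p.2 ∧ p.2 • g ≤ p.1 • w} =>
      (p.1.1 : ℝ) / p.1.2) := by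
  obtain ⟨N, _, h1, _⟩ := hw.2 g
  refine ⟨-N, ?_⟩
  rintro _ ⟨⟨⟨m, n⟩, hn, hmn⟩, rfl⟩
  have h2 : 0 ≤ (m + n * N : ℤ) • w := by
    have h3 := (nsmul_le_nsmul_right h1 n).trans hmn
    rw [smul_neg, ← sub_nonneg, sub_neg_eq_add] at h3
    rwa [add_smul, mul_smul, natCast_zsmul, natCast_zsmul]
  have h4 := hw.zsmul_nonneg_iff h0 h2
  have h5 : (0 : ℝ) ≤ m + n * N := by exact_mod_cast h4
  have hn' : (0 : ℝ) < n := by exact_mod_cast hn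
  change -(N : ℝ) ≤ m / n
  rw [le_div_iff₀ hn']
  linarith

theorem IsOrderUnit.gauge_le {w : K} (hw : IsOrderUnit w) (h0 : ¬ w ≤ 0) {g : K} (m : ℤ) (n : ℕ)
    (hn : 0 < n) (h : n • g ≤ m • w) : gauge w g ≤ m / n :=
  ciInf_le (hw.bddBelow_gauge h0 g) ⟨(m, n), hn, h⟩

theorem IsOrderUnit.le_gauge {K : Type*} [AddCommGroup K] [Preorder K]
    {w : K} (hw : IsOrderUnit w) {g : K} {r : ℝ}
    (h : ∀ (m : ℤ) (n : ℕ), 0 < n → n • g ≤ m • w → r ≤ m / n) : r ≤ gauge w g := by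
  obtain ⟨N, _, _, h2⟩ := hw.2 g
  have : Nonempty {p : ℤ × ℕ // 0 < p.2 ∧ p.2 • g ≤ p.1 • w} :=
    ⟨⟨(N, 1), one_pos, by simpa using h2⟩⟩
  exact le_ciInf fun p => h _ _ p.2.1 p.2.2

theorem IsOrderUnit.isSublinear_gauge {w : K} (hw : IsOrderUnit w) (h0 : ¬ w ≤ 0) :
    IsSublinear (gauge w) where
  add_le x y := by
    suffices gauge w (x + y) - gauge w y ≤ gauge w x by linarith
    refine hw.le_gauge fun m n hn hmn => ?_
    suffices gauge w (x + y) - m / n ≤ gauge w y by linarith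
    refine hw.le_gauge fun m' n' hn' hmn' => ?_
    have h : (n * n') • (x + y) ≤ (n' * m + n * m' : ℤ) • w := by
      have h1 := nsmul_le_nsmul_right hmn n'
      have h2 := nsmul_le_nsmul_right hmn' n
      have h3 := add_le_add h1 h2
      rw [← natCast_zsmul (m • w), ← natCast_zsmul (m' • w), ← mul_smul, ← mul_smul, ← mul_smul,
        ← mul_smul, ← add_smul, mul_comm n' n, ← nsmul_add] at h3
      exact h3
    have h4 := hw.gauge_le h0 _ _ (Nat.mul_pos hn hn') h
    have hn1 : (n : ℝ) ≠ 0 := by positivity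
    have hn2 : (n' : ℝ) ≠ 0 := by positivity
    have h5 : ((n' * m + n * m' : ℤ) : ℝ) / (n * n' : ℕ) = m / n + m' / n' := by
      push_cast
      field_simp
    linarith
  map_nsmul k x := by
    rcases Nat.eq_zero_or_pos k with rfl | hk
    · simp only [zero_smul, Nat.cast_zero, zero_mul]
      apply le_antisymm
      · simpa using hw.gauge_le h0 (g := (0 : K)) 0 1 one_pos (by simp)
      · refine hw.le_gauge fun m n hn hmn => ?_
        rw [smul_zero] at hmn
        have : (0 : ℝ) ≤ m := by exact_mod_cast hw.zsmul_nonneg_iff h0 hmn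
        positivity
    have hk' : (0 : ℝ) < k := by exact_mod_cast hk
    apply le_antisymm
    · rw [mul_comm, ← div_le_iff₀ hk']
      refine hw.le_gauge fun m n hn hmn => ?_
      have h := nsmul_le_nsmul_right hmn k
      rw [smul_comm k n x, ← natCast_zsmul (m • w) k, ← mul_smul (k : ℤ)] at h
      have h1 := hw.gauge_le h0 _ _ hn h
      rw [div_le_iff₀ hk']
      push_cast at h1
      calc _ ≤ _ := h1
        _ = _ := by ring
    · refine hw.le_gauge fun m n hn hmn => ?_
      rw [← mul_smul] at hmn
      have h1 := hw.gauge_le h0 m (n * k) (Nat.mul_pos hn hk) hmn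
      have hn' : (0 : ℝ) < n := by exact_mod_cast hn
      calc (k : ℝ) * gauge w x ≤ k * (m / (n * k : ℕ)) := by gcongr
        _ = m / n := by
          push_cast
          field_simp

/-- In an unperforated group with order unit, an element on which all normalized traces are
strictly positive is positive. -/
theorem IsOrderUnit.nonneg_of_forall_pos {w : K} (hw : IsOrderUnit w)
    (hK : ∀ (n : ℕ) (g : K), 0 < n → 0 ≤ n • g → 0 ≤ g) (c : K)
    (hc : ∀ θ ∈ normalizedTraces K w, 0 < θ c) : 0 ≤ c := by
  -- In this degenerate case the lower bound -(N • w) for c is itself nonnegative.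
  by_cases h0 : w ≤ 0
  · obtain ⟨N, _, h1, _⟩ := hw.2 c
    refine le_trans ?_ h1
    rw [neg_nonneg]
    exact nsmul_nonpos h0 N
  -- A map below the gauge is a normalized trace. Touching at -c gives gauge(-c) = -φ(c) < 0,
  -- whereas if c were not positive, unperforation would make every m / n in the infimum
  -- nonnegative.
  obtain ⟨φ, hφ, hφc⟩ := (hw.isSublinear_gauge h0).exists_addMonoidHom_le_eq (-c)
  have hpos : ∀ g, 0 ≤ g → 0 ≤ φ g := by
    intro g hg
    have h1 := hw.gauge_le h0 (g := -g) 0 1 one_pos (by simpa using hg)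
    have h2 := hφ (-g)
    rw [map_neg] at h2
    simp at h1
    linarith
  have hφw : φ w = 1 := by
    have h1 := hw.gauge_le h0 (g := w) 1 1 one_pos (by simp)
    have h2 := hw.gauge_le h0 (g := -w) (-1) 1 one_pos (by simp)
    have h3 := hφ w
    have h4 := hφ (-w)
    rw [map_neg] at h4
    simp at h1 h2
    linarith
  have hlt := hc φ (mem_normalizedTraces_of_nonneg hpos hφw)
  rw [map_neg] at hφc
  by_contra hneg
  have : 0 ≤ gauge w (-c) := by
    refine hw.le_gauge fun m n hn hmn => ?_
    have hm : 0 ≤ m := by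
      by_contra hm
      push Not at hm
      apply hneg
      refine hK n c hn ?_
      rw [smul_neg, neg_le] at hmn
      refine le_trans ?_ hmn
      rw [← neg_smul]
      exact zsmul_nonneg hw.1 (by omega)
    have : (0 : ℝ) ≤ m := by exact_mod_cast hm
    positivity
  linarith

/-- A positive map dominated by a multiple of an extreme normalized trace is a multiple of it. -/
theorem eq_smul_of_le_mul_extremePoint {u : K} (hu : IsOrderUnit u) {σ : K →+ ℝ}
    (hσ : σ ∈ (normalizedTraces K u).extremePoints ℝ) (φ : K →+ ℝ) (hφ : ∀ g, 0 ≤ g → 0 ≤ φ g)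
    (C : ℝ) (hC : ∀ g, 0 ≤ g → φ g ≤ C * σ g) (g : K) : φ g = φ u * σ g := by
  obtain ⟨hσS, hext⟩ := mem_extremePoints.1 hσ
  have hσu : σ u = 1 := hσS.2
  rcases (hφ u hu.1).eq_or_lt with h0 | hpos
  · obtain ⟨N, _, hN⟩ := hu.exists_bound g
    have := hN φ hφ
    rw [← h0, mul_zero, abs_nonpos_iff] at this
    rw [this, ← h0, zero_mul]
  -- D dominates C, so σ - φ / D is positive, and exceeds φ u, so t < 1. Then σ is the convex
  -- combination, with weights t and 1 - t, of the normalizations of φ and σ - φ / D.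
  set D : ℝ := max C 0 + φ u + 1 with hD
  have hDC : C ≤ D := by linarith [le_max_left C 0]
  have hDφ : φ u < D := by linarith [le_max_right C 0]
  have hD0 : 0 < D := hpos.trans hDφ
  set t : ℝ := φ u / D with ht
  have ht0 : 0 < t := div_pos hpos hD0
  have ht1 : 0 < 1 - t := by
    rw [sub_pos, ht, div_lt_one hD0]
    exact hDφ
  have h1 : (φ u)⁻¹ • φ ∈ normalizedTraces K u := by
    refine mem_normalizedTraces_of_nonneg (fun x hx => ?_) ?_
    · exact mul_nonneg (inv_nonneg.2 hpos.le) (hφ x hx)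
    · exact inv_mul_cancel₀ hpos.ne'
  have h2 : (1 - t)⁻¹ • (σ - D⁻¹ • φ) ∈ normalizedTraces K u := by
    refine mem_normalizedTraces_of_nonneg (fun x hx => ?_) ?_
    · refine mul_nonneg (inv_nonneg.2 ht1.le) ?_
      change 0 ≤ σ x - D⁻¹ * φ x
      rw [sub_nonneg, inv_mul_le_iff₀ hD0]
      exact (hC x hx).trans (mul_le_mul_of_nonneg_right hDC (hσS.1.2 x hx))
    · change (1 - t)⁻¹ * (σ u - D⁻¹ * φ u) = 1
      rw [hσu, show D⁻¹ * φ u = t by rw [ht]; ring]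
      exact inv_mul_cancel₀ ht1.ne'
  have h3 := (hext _ h1 _ h2 ⟨t, 1 - t, ht0, ht1, by ring, by
    rw [smul_smul, smul_smul, mul_inv_cancel₀ ht1.ne', one_smul, ht, div_mul_eq_mul_div,
      mul_inv_cancel₀ hpos.ne', one_div]
    abel⟩).1
  have h4 := DFunLike.congr_fun h3 g
  change (φ u)⁻¹ * φ g = σ g at h4
  rw [← h4, mul_inv_cancel_left₀ hpos.ne']

end Traces

/-! ### Order units and extreme traces of tensor products -/

section TensorTraces

variable {G : Type*} [AddCommGroup G] [Preorder G] [IsOrderedAddMonoid G]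
variable {H : Type*} [AddCommGroup H] [Preorder H] [IsOrderedAddMonoid H]

theorem tmul_le_tmul_left {G : Type*} [AddCommGroup G] [Preorder G]
    {g : G} {h h' : H} (hg : 0 ≤ g) (hh : h ≤ h') :
    g ⊗ₜ[ℤ] h ≤ g ⊗ₜ[ℤ] h' := by
  rw [← sub_nonneg, ← TensorProduct.tmul_sub]
  exact tmul_nonneg hg (sub_nonneg.2 hh)

theorem tmul_le_tmul_right {H : Type*} [AddCommGroup H] [Preorder H]
    {g g' : G} {h : H} (hg : g ≤ g') (hh : 0 ≤ h) :
    g ⊗ₜ[ℤ] h ≤ g' ⊗ₜ[ℤ] h := by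
  rw [← sub_nonneg, ← TensorProduct.sub_tmul]
  exact tmul_nonneg (sub_nonneg.2 hg) hh

/-- Expanding (N u + g) ⊗ (M v - h) ≥ 0 bounds g ⊗ h by N M u ⊗ v + M g ⊗ v - N u ⊗ h, and each of
the three terms is at most N M u ⊗ v. -/
theorem tmul_le_of_bounds {u g : G} {v h : H} (hu : 0 ≤ u) (hv : 0 ≤ v) {N M : ℕ}
    (hg : -(N • u) ≤ g) (hg' : g ≤ N • u) (hh : -(M • v) ≤ h) (hh' : h ≤ M • v) :
    g ⊗ₜ[ℤ] h ≤ (3 * (N * M)) • u ⊗ₜ[ℤ] v := by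
  have h1 := tmul_nonneg (neg_le_iff_add_nonneg.1 hg) (sub_nonneg.2 hh')
  have h2 := nsmul_le_nsmul_right (tmul_le_tmul_right hg' hv) M
  have h3 := nsmul_le_nsmul_right (tmul_le_tmul_left hu hh) N
  rw [← sub_nonneg] at h2 h3 ⊢
  have h4 := add_nonneg h1 (add_nonneg h2 h3)
  convert h4 using 1
  simp only [TensorProduct.add_tmul, TensorProduct.tmul_sub, TensorProduct.tmul_neg,
    ← TensorProduct.smul_tmul', TensorProduct.tmul_smul, smul_smul, smul_add, smul_neg]
  rw [mul_comm M N, show 3 * (N * M) = N * M + N * M + N * M by ring, add_smul, add_smul]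
  abel

theorem IsOrderUnit.tmul {u : G} {v : H} (hu : IsOrderUnit u) (hv : IsOrderUnit v) :
    IsOrderUnit (u ⊗ₜ[ℤ] v) := by
  refine ⟨tmul_nonneg hu.1 hv.1, fun z => ?_⟩
  induction z using TensorProduct.induction_on with
  | zero =>
    refine ⟨1, one_pos, ?_, ?_⟩
    · simpa using tmul_nonneg hu.1 hv.1
    · simpa using tmul_nonneg hu.1 hv.1
  | tmul g h =>
    obtain ⟨N, hN, h1, h2⟩ := hu.2 g
    obtain ⟨M, hM, h3, h4⟩ := hv.2 h
    refine ⟨3 * (N * M), by positivity, ?_, tmul_le_of_bounds hu.1 hv.1 h1 h2 h3 h4⟩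
    rw [neg_le, ← TensorProduct.neg_tmul]
    exact tmul_le_of_bounds hu.1 hv.1 (neg_le_neg_iff.2 h2) (neg_le.1 h1) h3 h4
  | add x y hx hy =>
    obtain ⟨N, hN, h1, h2⟩ := hx
    obtain ⟨M, hM, h3, h4⟩ := hy
    refine ⟨N + M, by positivity, ?_, ?_⟩
    · rw [add_smul, neg_add]
      exact add_le_add h1 h3
    · rw [add_smul]
      exact add_le_add h2 h4

/-- The additive map `g ↦ θ (g ⊗ h)`. -/
noncomputable def leftSlice (θ : G ⊗[ℤ] H →+ ℝ) (h : H) : G →+ ℝ :=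
  θ.comp ((TensorProduct.mk ℤ G H).flip h).toAddMonoidHom

/-- The additive map `h ↦ θ (g ⊗ h)`. -/
noncomputable def rightSlice (θ : G ⊗[ℤ] H →+ ℝ) (g : G) : H →+ ℝ :=
  θ.comp (TensorProduct.mk ℤ G H g).toAddMonoidHom

theorem leftSlice_apply {G : Type*} [AddCommGroup G] {H : Type*} [AddCommGroup H]
    (θ : G ⊗[ℤ] H →+ ℝ) (h : H) (g : G) :
    leftSlice θ h g = θ (g ⊗ₜ[ℤ] h) := rfl

theorem rightSlice_apply {G : Type*} [AddCommGroup G] {H : Type*} [AddCommGroup H]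
    (θ : G ⊗[ℤ] H →+ ℝ) (h : H) (g : G) :
    rightSlice θ g h = θ (g ⊗ₜ[ℤ] h) := rfl

theorem tensorTrace_nonneg {G : Type*} [AddCommGroup G] [Preorder G]
    {H : Type*} [AddCommGroup H] [Preorder H]
    {σ : G →+ ℝ} {τ : H →+ ℝ} (hσ : ∀ g, 0 ≤ g → 0 ≤ σ g)
    (hτ : ∀ h, 0 ≤ h → 0 ≤ τ h) (z : G ⊗[ℤ] H) (hz : 0 ≤ z) : 0 ≤ tensorTrace σ τ z := by
  rw [tensor_nonneg_iff] at hz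
  induction hz using AddSubmonoid.closure_induction with
  | mem z hz =>
    obtain ⟨g, h, hg, hh, rfl⟩ := hz
    rw [tensorTrace_tmul]
    exact mul_nonneg (hσ g hg) (hτ h hh)
  | zero => rw [map_zero]
  | add x y _ _ hx hy =>
    rw [map_add]
    exact add_nonneg hx hy

theorem tensorTrace_mem_normalizedTraces {G : Type*} [AddCommGroup G] [Preorder G]
    {H : Type*} [AddCommGroup H] [Preorder H] {u : G} {v : H} {σ : G →+ ℝ} {τ : H →+ ℝ}
    (hσ : σ ∈ normalizedTraces G u) (hτ : τ ∈ normalizedTraces H v) :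
    tensorTrace σ τ ∈ normalizedTraces (G ⊗[ℤ] H) (u ⊗ₜ[ℤ] v) :=
  mem_normalizedTraces_of_nonneg (tensorTrace_nonneg hσ.1.2 hτ.1.2)
    (by rw [tensorTrace_tmul, hσ.2, hτ.2, one_mul])

/-- The tensor product of extreme normalized traces is an extreme normalized trace. -/
theorem tensorTrace_mem_extremePoints (hH : ∀ h : H, ∃ p q : H, 0 ≤ p ∧ 0 ≤ q ∧ h = p - q)
    {u : G} {v : H} (hu : IsOrderUnit u)
    (hv : IsOrderUnit v) {σ : G →+ ℝ} {τ : H →+ ℝ}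
    (hσ : σ ∈ (normalizedTraces G u).extremePoints ℝ)
    (hτ : τ ∈ (normalizedTraces H v).extremePoints ℝ) :
    tensorTrace σ τ ∈ (normalizedTraces (G ⊗[ℤ] H) (u ⊗ₜ[ℤ] v)).extremePoints ℝ := by
  have key : ∀ ρ₁ ∈ normalizedTraces (G ⊗[ℤ] H) (u ⊗ₜ[ℤ] v), ∀ C : ℝ,
      (∀ z, 0 ≤ z → ρ₁ z ≤ C * tensorTrace σ τ z) → ρ₁ = tensorTrace σ τ := by
    intro ρ₁ h₁ C hC
    -- For h ≥ 0 the slice is positive and below C τ(h) σ, so extremality of σ applies; general h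
    -- are reached by directedness.
    have h2 : ∀ h, 0 ≤ h → ∀ g, ρ₁ (g ⊗ₜ[ℤ] h) = ρ₁ (u ⊗ₜ[ℤ] h) * σ g := by
      intro h hh
      refine eq_smul_of_le_mul_extremePoint hu hσ (leftSlice ρ₁ h)
        (fun g hg => h₁.1.2 _ (tmul_nonneg hg hh)) (C * τ h) fun g hg => ?_
      have := hC _ (tmul_nonneg hg hh)
      rw [tensorTrace_tmul] at this
      rw [leftSlice_apply]
      linarith
    have h3 : ∀ h, ρ₁ (u ⊗ₜ[ℤ] h) = ρ₁ (u ⊗ₜ[ℤ] v) * τ h := by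
      refine eq_smul_of_le_mul_extremePoint hv hτ (rightSlice ρ₁ u)
        (fun h hh => h₁.1.2 _ (tmul_nonneg hu.1 hh)) (C * σ u) fun h hh => ?_
      have := hC _ (tmul_nonneg hu.1 hh)
      rw [tensorTrace_tmul] at this
      rw [rightSlice_apply]
      linarith
    ext z
    induction z using TensorProduct.induction_on with
    | zero => simp
    | tmul g h =>
      obtain ⟨p, q, hp, hq, rfl⟩ := hH h
      rw [TensorProduct.tmul_sub, map_sub, map_sub, tensorTrace_tmul, tensorTrace_tmul, h2 p hp,
        h2 q hq, h3 p, h3 q, h₁.2]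
      ring
    | add x y hx hy => rw [map_add, map_add, hx, hy]
  rw [mem_extremePoints]
  have hσS := (mem_extremePoints.1 hσ).1
  have hτS := (mem_extremePoints.1 hτ).1
  have hbound : ∀ a b : ℝ, 0 < a → 0 < b → ∀ ρ₁ ρ₂ : G ⊗[ℤ] H →+ ℝ,
      (∀ z, 0 ≤ z → 0 ≤ ρ₂ z) → a • ρ₁ + b • ρ₂ = tensorTrace σ τ →
      ∀ z, 0 ≤ z → ρ₁ z ≤ a⁻¹ * tensorTrace σ τ z := by
    intro a b ha hb ρ₁ ρ₂ h₂ hab z hz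
    rw [le_inv_mul_iff₀ ha, ← hab]
    change a * ρ₁ z ≤ a * ρ₁ z + b * ρ₂ z
    linarith [mul_nonneg hb.le (h₂ z hz)]
  refine ⟨tensorTrace_mem_normalizedTraces hσS hτS, ?_⟩
  rintro ρ₁ h₁ ρ₂ h₂ ⟨a, b, ha, hb, _, hρ⟩
  exact ⟨key ρ₁ h₁ _ (hbound a b ha hb ρ₁ ρ₂ h₂.1.2 hρ),
    key ρ₂ h₂ _ (hbound b a hb ha ρ₂ ρ₁ h₁.1.2 (by rw [add_comm]; exact hρ))⟩

theorem tensorTrace_smul_smul {G : Type*} [AddCommGroup G] {H : Type*} [AddCommGroup H]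
    (a b : ℝ) (σ : G →+ ℝ) (τ : H →+ ℝ) :
    tensorTrace (a • σ) (b • τ) = (a * b) • tensorTrace σ τ := by
  ext z
  induction z using TensorProduct.induction_on with
  | zero => simp
  | tmul g h =>
    change _ = (a * b) * tensorTrace σ τ (g ⊗ₜ[ℤ] h)
    rw [tensorTrace_tmul, tensorTrace_tmul]
    change a * σ g * (b * τ h) = _
    ring
  | add x y hx hy => rw [map_add, map_add, hx, hy]

end TensorTraces

/-! ### Uniform approximate division in a dimension group -/

section ApproximateDivisibility

variable {G : Type*} [AddCommGroup G] [PartialOrder G] [IsOrderedAddMonoid G]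

/-- For an extreme trace `σ` of a dimension group, `max (σ g) 0` is the infimum of the values of
`σ` on the positive upper bounds of `g`. -/
theorem IsDimensionGroup.exists_nonneg_ge_of_extremePoint (hG : IsDimensionGroup G) {u : G}
    (hu : IsOrderUnit u) {σ : G →+ ℝ} (hσ : σ ∈ (normalizedTraces G u).extremePoints ℝ) (g : G)
    {ε : ℝ} (hε : 0 < ε) : ∃ z, 0 ≤ z ∧ g ≤ z ∧ σ z < max (σ g) 0 + ε := by
  have hpos := (mem_extremePoints.1 hσ).1.1.2
  have hne : ∀ g : G, Nonempty {z : G // 0 ≤ z ∧ g ≤ z} := by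
    intro g
    obtain ⟨p, q, hp, hq, rfl⟩ := hG.directed g
    exact ⟨⟨p, hp, sub_le_self p hq⟩⟩
  set p : G → ℝ := fun g => ⨅ z : {z : G // 0 ≤ z ∧ g ≤ z}, σ z with hp
  have hle : ∀ g z, 0 ≤ z → g ≤ z → p g ≤ σ z := fun g z h0 h1 =>
    ciInf_le (f := fun z : {z : G // 0 ≤ z ∧ g ≤ z} => σ z)
      ⟨0, by rintro _ ⟨z, rfl⟩; exact hpos _ z.2.1⟩ ⟨z, h0, h1⟩
  have hge : ∀ g r, (∀ z, 0 ≤ z → g ≤ z → r ≤ σ z) → r ≤ p g := fun g r h =>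
    le_ciInf fun z => h z z.2.1 z.2.2
  have hsub : IsSublinear p := by
    refine ⟨fun x y => ?_, fun k x => ?_⟩
    · refine le_ciInf_add_ciInf fun z w => ?_
      rw [← map_add]
      exact hle _ _ (add_nonneg z.2.1 w.2.1) (add_le_add z.2.2 w.2.2)
    · rcases Nat.eq_zero_or_pos k with rfl | hk
      · rw [zero_smul, Nat.cast_zero, zero_mul]
        apply le_antisymm
        · simpa using hle 0 0 le_rfl le_rfl
        · exact hge _ _ fun z hz _ => hpos z hz
      have hk' : (0 : ℝ) < k := by exact_mod_cast hk
      apply le_antisymm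
      · rw [mul_comm, ← div_le_iff₀ hk']
        refine hge _ _ fun z hz hxz => ?_
        rw [div_le_iff₀ hk']
        have := hle (k • x) (k • z) (nsmul_nonneg hz k) (nsmul_le_nsmul_right hxz k)
        rw [map_nsmul, nsmul_eq_mul] at this
        linarith
      · refine hge _ _ fun z hz hxz => ?_
        -- The nontrivial half of homogeneity: a positive upper bound z of k x is divided by k,
        -- giving a positive upper bound c of x with k c ≤ z.
        obtain ⟨c, hc1, hc2, hc3⟩ := hG.exists_ge_ge_nsmul_le k x 0 z hxz (by simpa using hz)
        have h1 := hle x c hc2 hc1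
        have h2 := monotone_of_nonneg hpos hc3
        rw [map_nsmul, nsmul_eq_mul] at h2
        exact (mul_le_mul_of_nonneg_left h1 hk'.le).trans h2
  -- This φ is positive and below σ on the cone, hence φ = φ(u) σ with 0 ≤ φ(u) ≤ 1, and p(g) = φ(u)
  -- σ(g) ≤ max (σ g) 0.
  obtain ⟨φ, hφ, hφg⟩ := hsub.exists_addMonoidHom_le_eq g
  have hφ0 : ∀ x, 0 ≤ x → 0 ≤ φ x := by
    intro x hx
    have h1 := (hφ (-x)).trans (hle (-x) 0 le_rfl (neg_nonpos.2 hx))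
    rw [map_neg, map_zero] at h1
    linarith
  have hφσ : ∀ x, 0 ≤ x → φ x ≤ 1 * σ x := fun x hx => by
    rw [one_mul]
    exact (hφ x).trans (hle x x hx le_rfl)
  have h1 := eq_smul_of_le_mul_extremePoint hu hσ φ hφ0 1 hφσ g
  have h2 : φ u ≤ 1 := by
    have := hφσ u hu.1
    rwa [(mem_extremePoints.1 hσ).1.2, mul_one] at this
  have h3 : p g < max (σ g) 0 + ε := by
    rw [← hφg, h1]
    have : φ u * σ g ≤ max (σ g) 0 := by
      rcases le_total 0 (σ g) with h | h
      · exact (mul_le_of_le_one_left h h2).trans (le_max_left _ _)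
      · exact (mul_nonpos_of_nonneg_of_nonpos (hφ0 u hu.1) h).trans (le_max_right _ _)
    linarith
  obtain ⟨z, hz⟩ := exists_lt_of_ciInf_lt h3
  exact ⟨z, z.2.1, z.2.2, hz⟩

theorem exists_small_of_not_discreteTopology {G : Type*} [AddCommGroup G] {σ : G →+ ℝ}
    (h : ¬ DiscreteTopology σ.range) {δ : ℝ} (hδ : 0 < δ) : ∃ g, 0 < σ g ∧ σ g < δ := by
  rcases σ.range.dense_or_cyclic with hd | ⟨a, ha⟩
  · obtain ⟨_, ⟨g, rfl⟩, hg⟩ := hd.exists_between hδ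
    exact ⟨g, hg⟩
  · rw [ha, ← AddSubgroup.zmultiples_eq_closure] at h
    exact absurd (inferInstance : DiscreteTopology (AddSubgroup.zmultiples a)) h

/-- Non-discreteness gives z ≥ 0 of tiny positive trace. A multiple of N z matches x under σ up to N
σ(z), and a positive t of small trace repairs the failure of N M z ≤ x. -/
theorem IsDimensionGroup.exists_nsmul_le_of_extremePoint (hG : IsDimensionGroup G) {u : G}
    (hu : IsOrderUnit u) {σ : G →+ ℝ} (hσ : σ ∈ (normalizedTraces G u).extremePoints ℝ)
    (hd : ¬ DiscreteTopology σ.range) (x : G) {N : ℕ} (hN : 0 < N) {ε : ℝ} (hε : 0 < ε) :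
    ∃ y, N • y ≤ x ∧ σ (x - N • y) < ε := by
  have hpos := (mem_extremePoints.1 hσ).1.1.2
  have hN' : (0 : ℝ) < N := by exact_mod_cast hN
  -- The final defect is below N σ(z) + N σ(t), with σ(z) < 2δ and σ(t) < δ, so it is below 3ε/4.
  set δ : ℝ := ε / (4 * N) with hδ
  have hδ0 : 0 < δ := by positivity
  have hNδ : N * δ = ε / 4 := by
    rw [hδ]
    field_simp
  obtain ⟨g, hg0, hgδ⟩ := exists_small_of_not_discreteTopology hd hδ0
  obtain ⟨z, hz0, hgz, hz⟩ := hG.exists_nonneg_ge_of_extremePoint hu hσ g hδ0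
  rw [max_eq_left hg0.le] at hz
  have hη0 : 0 < σ z := hg0.trans_le (monotone_of_nonneg hpos hgz)
  have hNη : 0 < N * σ z := mul_pos hN' hη0
  set M : ℤ := ⌊σ x / (N * σ z)⌋ with hM
  have hM1 : M * (N * σ z) ≤ σ x := by
    rw [← le_div_iff₀ hNη]
    exact Int.floor_le _
  have hM2 : σ x < (M + 1) * (N * σ z) := by
    rw [← div_lt_iff₀ hNη]
    exact Int.lt_floor_add_one _
  obtain ⟨t, ht0, htx, ht⟩ :=
    hG.exists_nonneg_ge_of_extremePoint hu hσ (N • (M • z) - x) hδ0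
  have hval : σ (N • (M • z)) = M * (N * σ z) := by
    rw [map_nsmul, map_zsmul, nsmul_eq_mul, zsmul_eq_mul]
    ring
  rw [map_sub, hval, max_eq_right (by linarith), zero_add] at ht
  refine ⟨M • z - t, ?_, ?_⟩
  · have h1 : t ≤ N • t := by simpa using nsmul_le_nsmul_left ht0 hN
    rw [smul_sub]
    calc N • (M • z) - N • t ≤ N • (M • z) - t := sub_le_sub_left h1 _
      _ ≤ x := by rw [sub_le_comm]; exact htx
  · rw [smul_sub, map_sub, map_sub, hval, map_nsmul, nsmul_eq_mul]
    have h1 : N * σ t < ε / 4 := by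
      rw [← hNδ]
      exact mul_lt_mul_of_pos_left ht hN'
    have h2 : N * σ z < ε / 2 := by
      have := mul_lt_mul_of_pos_left (show σ z < 2 * δ by linarith) hN'
      linarith
    linarith

/-- The normalized traces, as a set of functions. -/
def traceFunctions (u : G) : Set (G → ℝ) :=
  {f | (∀ x y, f (x + y) = f x + f y) ∧ (∀ x, 0 ≤ x → 0 ≤ f x) ∧ f u = 1}

theorem coe_mem_traceFunctions {G : Type*} [AddCommGroup G] [PartialOrder G]
    {u : G} {θ : G →+ ℝ} (hθ : θ ∈ normalizedTraces G u) :
    ⇑θ ∈ traceFunctions u :=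
  ⟨map_add θ, hθ.1.2, hθ.2⟩

theorem exists_coe_eq_of_mem_traceFunctions {G : Type*} [AddCommGroup G] [PartialOrder G]
    {u : G} {f : G → ℝ} (hf : f ∈ traceFunctions u) :
    ∃ θ ∈ normalizedTraces G u, ⇑θ = f :=
  ⟨AddMonoidHom.mk' f hf.1, mem_normalizedTraces_of_nonneg hf.2.1 hf.2.2, rfl⟩

theorem isClosed_traceFunctions {G : Type*} [AddCommGroup G] [PartialOrder G]
    (u : G) : IsClosed (traceFunctions u) := by
  have : traceFunctions u = (⋂ (x : G) (y : G), {f : G → ℝ | f (x + y) = f x + f y}) ∩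
      ((⋂ (x : G) (_ : 0 ≤ x), {f : G → ℝ | 0 ≤ f x}) ∩ {f : G → ℝ | f u = 1}) := by
    ext f
    simp [traceFunctions]
  rw [this]
  refine IsClosed.inter ?_ (IsClosed.inter ?_ ?_)
  · exact isClosed_iInter fun x => isClosed_iInter fun y =>
      isClosed_eq (continuous_apply _) ((continuous_apply x).add (continuous_apply y))
  · exact isClosed_iInter fun x => isClosed_iInter fun _ =>
      isClosed_le continuous_const (continuous_apply x)
  · exact isClosed_eq (continuous_apply u) continuous_const

/-- Tychonoff: the order unit confines the value of a normalized trace at each g to a fixed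
interval. -/
theorem isCompact_traceFunctions {u : G} (hu : IsOrderUnit u) : IsCompact (traceFunctions u) := by
  choose N _ hN using hu.exists_bound
  refine (isCompact_univ_pi fun g => isCompact_Icc (a := -(N g : ℝ)) (b := N g)).of_isClosed_subset
    (isClosed_traceFunctions u) fun f hf g _ => ?_
  obtain ⟨θ, hθ, rfl⟩ := exists_coe_eq_of_mem_traceFunctions hf
  have := hN g θ hθ.1.2
  rw [hθ.2, mul_one] at this
  exact abs_le.1 this

theorem mem_extremePoints_of_coe_mem {G : Type*} [AddCommGroup G] [PartialOrder G]
    {u : G} {θ : G →+ ℝ}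
    (hθ : ⇑θ ∈ (traceFunctions u).extremePoints ℝ) :
    θ ∈ (normalizedTraces G u).extremePoints ℝ := by
  obtain ⟨h1, h2⟩ := mem_extremePoints_iff_left.1 hθ
  refine mem_extremePoints_iff_left.2
    ⟨mem_normalizedTraces_of_nonneg h1.2.1 h1.2.2, fun x₁ hx₁ x₂ hx₂ => ?_⟩
  rintro ⟨a, b, ha, hb, hab, rfl⟩
  exact DFunLike.coe_injective (h2 _ (coe_mem_traceFunctions hx₁) _ (coe_mem_traceFunctions hx₂)
    ⟨a, b, ha, hb, hab, rfl⟩)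

/-- A downward directed family of evaluations attains its largest infimum at an extreme trace. -/
theorem exists_extremePoint_of_directed {u : G} (hu : IsOrderUnit u) {ι : Type*} [Nonempty ι]
    (w : ι → G) (hw0 : ∀ i, 0 ≤ w i) (hw : ∀ i j, ∃ k, w k ≤ w i ∧ w k ≤ w j) {ε : ℝ}
    (h : ∀ i, ∃ θ ∈ normalizedTraces G u, ε ≤ θ (w i)) :
    ∃ θ ∈ (normalizedTraces G u).extremePoints ℝ, ∀ i, ε ≤ θ (w i) := by
  have hmono : ∀ f ∈ traceFunctions u, Monotone f := by
    intro f hf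
    obtain ⟨θ, hθ, rfl⟩ := exists_coe_eq_of_mem_traceFunctions hf
    exact monotone_of_nonneg hθ.1.2
  have hclosed : ∀ (r : ℝ) i, IsClosed {f : G → ℝ | r ≤ f (w i)} := fun r i =>
    isClosed_le continuous_const (continuous_apply _)
  have hcomp := isCompact_traceFunctions hu
  obtain ⟨f₀, hf₀⟩ := IsCompact.nonempty_iInter_of_directed_nonempty_isCompact_isClosed
    (fun i => traceFunctions u ∩ {f : G → ℝ | ε ≤ f (w i)})
    (by
      intro i j
      obtain ⟨k, hki, hkj⟩ := hw i j
      exact ⟨k, fun f hf => ⟨hf.1, hf.2.trans (hmono f hf.1 hki)⟩,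
        fun f hf => ⟨hf.1, hf.2.trans (hmono f hf.1 hkj)⟩⟩)
    (fun i => by
      obtain ⟨θ, hθ, hi⟩ := h i
      exact ⟨θ, coe_mem_traceFunctions hθ, hi⟩)
    (fun i => hcomp.inter_right (hclosed ε i))
    (fun i => hcomp.isClosed.inter (hclosed ε i))
  rw [Set.mem_iInter] at hf₀
  have hf₀T : f₀ ∈ traceFunctions u := (hf₀ (Classical.arbitrary ι)).1
  have hbdd : ∀ f ∈ traceFunctions u, BddBelow (Set.range fun i => f (w i)) := fun f hf =>
    ⟨0, by rintro _ ⟨i, rfl⟩; exact hf.2.1 _ (hw0 i)⟩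
  -- An infimum of evaluations is upper semicontinuous, so it attains a maximum m ≥ ε on the compact
  -- trace space; F below is the set where it is attained.
  obtain ⟨f₁, hf₁, hmax⟩ := UpperSemicontinuousOn.exists_isMaxOn ⟨f₀, hf₀T⟩ hcomp
    (upperSemicontinuousOn_ciInf (f := fun i (f : G → ℝ) => f (w i)) hbdd
      fun i => (continuous_apply (w i)).upperSemicontinuous.upperSemicontinuousOn _)
  set m : ℝ := ⨅ i, f₁ (w i) with hm
  have hmax' : ∀ f ∈ traceFunctions u, (⨅ i, f (w i)) ≤ m := fun f hf => hmax hf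
  have hεm : ε ≤ m := (le_ciInf fun i => (hf₀ i).2).trans (hmax' f₀ hf₀T)
  set F : Set (G → ℝ) := traceFunctions u ∩ ⋂ i, {f : G → ℝ | m ≤ f (w i)} with hF
  have hFmem : ∀ f, f ∈ F ↔ f ∈ traceFunctions u ∧ ∀ i, m ≤ f (w i) := by
    intro f
    simp [hF]
  have hFcomp : IsCompact F := hcomp.inter_right (isClosed_iInter (hclosed m))
  obtain ⟨e, he⟩ := hFcomp.extremePoints_nonempty
    ⟨f₁, (hFmem _).2 ⟨hf₁, fun i => ciInf_le (hbdd f₁ hf₁) i⟩⟩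
  obtain ⟨heF, hext⟩ := mem_extremePoints_iff_left.1 he
  -- The infimum over a downward directed family behaves affinely: if x fell below m at w i, a
  -- common lower bound with a near-minimizing w j for y would push e below m. So an extreme point
  -- of F is extreme among all normalized traces.
  have hface : ∀ a b : ℝ, 0 < a → 0 < b → a + b = 1 → ∀ x ∈ traceFunctions u,
      ∀ y ∈ traceFunctions u, a • x + b • y = e → x ∈ F := by
    intro a b ha hb hab x hx y hy hxy
    refine (hFmem x).2 ⟨hx, fun i => ?_⟩
    by_contra hlt
    push Not at hlt
    have hs : (⨅ j, y (w j)) < m + a * (m - x (w i)) / b := by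
      refine (hmax' y hy).trans_lt (lt_add_of_pos_right _ ?_)
      exact div_pos (mul_pos ha (sub_pos.2 hlt)) hb
    obtain ⟨j, hj⟩ := exists_lt_of_ciInf_lt hs
    obtain ⟨k, hki, hkj⟩ := hw i j
    have h1 := ((hFmem e).1 heF).2 k
    rw [← hxy] at h1
    change m ≤ a * x (w k) + b * y (w k) at h1
    have h2 := mul_le_mul_of_nonneg_left (hmono x hx hki) ha.le
    have h3 := mul_lt_mul_of_pos_left ((hmono y hy hkj).trans_lt hj) hb
    rw [mul_add, mul_div_cancel₀ _ hb.ne'] at h3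
    have h4 : a * m + b * m = m := by rw [← add_mul, hab, one_mul]
    linarith
  obtain ⟨θ, hθ, rfl⟩ := exists_coe_eq_of_mem_traceFunctions ((hFmem e).1 heF).1
  refine ⟨θ, mem_extremePoints_of_coe_mem (mem_extremePoints_iff_left.2
    ⟨((hFmem _).1 heF).1, fun x hx y hy => ?_⟩), fun i => hεm.trans (((hFmem _).1 heF).2 i)⟩
  rintro ⟨a, b, ha, hb, hab, hxy⟩
  exact hext x (hface a b ha hb hab x hx y hy hxy) y
    (hface b a hb ha (by linarith) y hy x hx (by rw [add_comm]; exact hxy)) ⟨a, b, ha, hb, hab, hxy⟩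

/-- The remainders x - N y form a downward directed family. If none were uniformly below ε, a single
extreme trace would be at least ε on all of them, contradicting
`IsDimensionGroup.exists_nsmul_le_of_extremePoint`. -/
theorem IsDimensionGroup.exists_nsmul_le (hG : IsDimensionGroup G)
    (hdiv : IsApproximatelyDivisible G) {u : G} (hu : IsOrderUnit u) (x : G) {N : ℕ} (hN : 0 < N)
    {ε : ℝ} (hε : 0 < ε) : ∃ y, N • y ≤ x ∧ ∀ θ ∈ normalizedTraces G u, θ (x - N • y) < ε := by
  by_contra hcon
  push Not at hcon
  obtain ⟨n, _, hn, _⟩ := hu.2 x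
  have : Nonempty {y : G // N • y ≤ x} := by
    refine ⟨⟨-(n • u), le_trans ?_ hn⟩⟩
    rw [smul_neg, neg_le_neg_iff]
    simpa using nsmul_le_nsmul_left (nsmul_nonneg hu.1 n) hN
  obtain ⟨σ, hσ, hσε⟩ := exists_extremePoint_of_directed hu
    (fun y : {y : G // N • y ≤ x} => x - N • y.1) (fun y => sub_nonneg.2 y.2)
    (fun y z => by
      obtain ⟨c, hyc, hzc, hc⟩ := hG.exists_ge_ge_nsmul_le N _ _ x y.2 z.2
      exact ⟨⟨c, hc⟩, sub_le_sub_left (nsmul_le_nsmul_right hyc N) x,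
        sub_le_sub_left (nsmul_le_nsmul_right hzc N) x⟩)
    (fun y => hcon y.1 y.2)
  have hS := (mem_extremePoints.1 hσ).1
  have hpure : IsPureTrace σ := ⟨hS.1, u, hu, by rwa [hS.2, inv_one, one_smul]⟩
  obtain ⟨y, hy, hyε⟩ :=
    hG.exists_nsmul_le_of_extremePoint hu hσ (hdiv.2 σ hpure) x hN hε
  exact absurd (hσε ⟨y, hy⟩) (not_le.2 hyε)

/-- In an approximately divisible dimension group, real multiples of elements are uniformly
approximated by elements. -/
theorem IsDimensionGroup.exists_approx_smul (hG : IsDimensionGroup G)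
    (hdiv : IsApproximatelyDivisible G) {u : G} (hu : IsOrderUnit u) (x : G) (r : ℝ)
    {ε : ℝ} (hε : 0 < ε) : ∃ y, ∀ θ ∈ normalizedTraces G u, |θ y - r * θ x| < ε := by
  obtain ⟨B, hB, hBx⟩ := hu.exists_bound x
  obtain ⟨N, hN⟩ := exists_nat_gt (2 * B / ε)
  have hB' : (0 : ℝ) < B := by exact_mod_cast hB
  have hN' : (0 : ℝ) < N := lt_trans (by positivity) hN
  have hN1 : (1 : ℝ) ≤ N := by exact_mod_cast (by exact_mod_cast hN' : 0 < N)
  obtain ⟨y, hy, hyε⟩ := hG.exists_nsmul_le hdiv hu x (N := N) (by exact_mod_cast hN')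
    (ε := ε / (2 * (|r| + 1))) (by positivity)
  -- With q = ⌊r N⌋ / N and remainder e = θ(x - N y), the error is (q - r) θ(x) - q e. The size of N
  -- controls the first term, the precision of y the second.
  refine ⟨⌊r * N⌋ • y, fun θ hθ => ?_⟩
  have h1 := hyε θ hθ
  have h2 := hθ.1.2 _ (sub_nonneg.2 hy)
  have h3 := hBx θ hθ.1.2
  rw [hθ.2, mul_one] at h3
  rw [map_zsmul, zsmul_eq_mul]
  set e := θ (x - N • y) with he
  have h4 : θ y = (θ x - e) / N := by
    rw [he, map_sub, map_nsmul, nsmul_eq_mul]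
    field_simp
    ring
  set q : ℝ := (⌊r * N⌋ : ℝ) / N with hq
  have h5 : |q - r| ≤ 1 / N := by
    rw [abs_le, hq]
    have h6 := Int.floor_le (r * N)
    have h7 := Int.lt_floor_add_one (r * N)
    constructor
    · rw [← sub_nonneg, show (⌊r * N⌋ : ℝ) / N - r - -(1 / N) = (⌊r * N⌋ + 1 - r * N) / N by
        field_simp
        ring]
      exact div_nonneg (by linarith) hN'.le
    · rw [← sub_nonneg, show 1 / (N : ℝ) - (⌊r * N⌋ / N - r) = (1 + r * N - ⌊r * N⌋) / N by
        field_simp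
        ring]
      exact div_nonneg (by linarith) hN'.le
  have h6 : |q| ≤ |r| + 1 := by
    have h7 : |q| ≤ |q - r| + |r| := by simpa using abs_add_le (q - r) r
    have h8 : 1 / (N : ℝ) ≤ 1 := by rw [div_le_one hN']; exact hN1
    linarith
  have h7 : ⌊r * N⌋ * θ y - r * θ x = (q - r) * θ x - q * e := by
    rw [h4, hq]
    ring
  rw [h7]
  refine (abs_sub _ _).trans_lt ?_
  rw [abs_mul, abs_mul, abs_of_nonneg h2]
  have h8 : |q - r| * |θ x| ≤ 1 / N * B :=
    mul_le_mul h5 h3 (abs_nonneg _) (by positivity)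
  have h9 : 1 / (N : ℝ) * B < ε / 2 := by
    rw [div_lt_iff₀ hε] at hN
    rw [one_div, inv_mul_lt_iff₀ hN']
    linarith
  have h10 : |q| * e ≤ (|r| + 1) * (ε / (2 * (|r| + 1))) :=
    mul_le_mul h6 h1.le h2 (by positivity)
  have h11 : (|r| + 1) * (ε / (2 * (|r| + 1))) = ε / 2 := by
    have : |r| + 1 ≠ 0 := by positivity
    field_simp
  linarith

theorem IsOrderUnit.of_forall_pos {u : G} (hG : IsDimensionGroup G) (hu : IsOrderUnit u) {b : G}
    {δ : ℝ} (hδ : 0 < δ) (hb : ∀ θ ∈ normalizedTraces G u, δ < θ b) : IsOrderUnit b := by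
  obtain ⟨n, hn⟩ := exists_nat_gt (1 / δ)
  have hn0 : (0 : ℝ) < n := lt_trans (by positivity) hn
  rw [div_lt_iff₀ hδ] at hn
  refine hu.of_le_nsmul (hu.nonneg_of_forall_pos hG.unperforated b
    fun θ hθ => hδ.trans (hb θ hθ)) n (sub_nonneg.1 (hu.nonneg_of_forall_pos hG.unperforated _
    fun θ hθ => ?_))
  rw [map_sub, map_nsmul, nsmul_eq_mul, hθ.2]
  have := mul_lt_mul_of_pos_left (hb θ hθ) hn0
  linarith

/-- If `σ` is order unit good, every value of `σ` is attained at an element which is uniformly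
close to a multiple of the order unit. -/
theorem IsDimensionGroup.exists_approx_const (hG : IsDimensionGroup G)
    (hdiv : IsApproximatelyDivisible G) {u : G} (hu : IsOrderUnit u) {σ : G →+ ℝ}
    (hσ : σ ∈ normalizedTraces G u) (hgood : IsOrderUnitGood σ) (g : G) {ε : ℝ} (hε : 0 < ε) :
    ∃ s, σ s = σ g ∧ ∀ θ ∈ normalizedTraces G u, |θ s - σ g| < ε := by
  -- p sits about ε/2 below the target and b is about 3ε/4, so σ(g - p) < 5ε/8 < σ(b). Any 0 ≤ c ≤ b
  -- with σ(c) = σ(g - p) then keeps p + c within ε of the target at every trace.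
  obtain ⟨p, hp⟩ := hG.exists_approx_smul hdiv hu u (σ g - ε / 2) (ε := ε / 8) (by positivity)
  obtain ⟨b, hb⟩ := hG.exists_approx_smul hdiv hu u (3 * ε / 4) (ε := ε / 8) (by positivity)
  have hp' : ∀ θ ∈ normalizedTraces G u, |θ p - (σ g - ε / 2)| < ε / 8 := fun θ hθ => by
    simpa [hθ.2] using hp θ hθ
  have hb' : ∀ θ ∈ normalizedTraces G u, |θ b - 3 * ε / 4| < ε / 8 := fun θ hθ => by
    simpa [hθ.2] using hb θ hθ
  have hbu : IsOrderUnit b := hu.of_forall_pos hG (δ := ε / 2) (by positivity) fun θ hθ => by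
    have := (abs_lt.1 (hb' θ hθ)).1
    linarith
  have hσp := abs_lt.1 (hp' σ hσ)
  have hσb := abs_lt.1 (hb' σ hσ)
  -- g - p has positive trace but need not be positive. Writing it as x - y and adding u to both
  -- parts makes x + u an order unit and y + u nonzero, so goodness gives c ≤ x + u with σ(c) = σ(y
  -- + u).
  obtain ⟨a, ha0, ha⟩ : ∃ a, 0 ≤ a ∧ σ a = σ (g - p) := by
    obtain ⟨x, y, hx, hy, hxy⟩ := hG.directed (g - p)
    have hyu : σ (y + u) ≠ 0 := by
      rw [map_add, hσ.2]
      have := hσ.1.2 y hy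
      positivity
    obtain ⟨c, _, hcx, hc⟩ := hgood (y + u) (x + u) (add_nonneg hy hu.1)
      (fun h => hyu (by rw [h, map_zero])) (hu.mono (le_add_of_nonneg_left hx)) (by
        have h1 : σ (g - p) = σ x - σ y := by rw [hxy, map_sub]
        rw [map_sub] at h1
        rw [map_add, map_add]
        linarith)
    refine ⟨x + u - c, sub_nonneg.2 hcx, ?_⟩
    rw [map_sub, hc, hxy, map_add, map_add, map_sub]
    ring
  rw [map_sub] at ha
  obtain ⟨c, hc0, hcb, hc⟩ := hgood a b ha0
    (by
      rintro rfl
      rw [map_zero] at ha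
      linarith) hbu (by linarith)
  refine ⟨p + c, by rw [map_add, hc, ha]; ring, fun θ hθ => ?_⟩
  have h1 := abs_lt.1 (hp' θ hθ)
  have h2 := abs_lt.1 (hb' θ hθ)
  have h3 := hθ.1.2 c hc0
  have h4 := monotone_of_nonneg hθ.1.2 hcb
  rw [map_add, abs_lt]
  constructor <;> linarith

end ApproximateDivisibility

/-! ### Uniform approximation and goodness in the tensor product -/

section TensorApproximation

variable {G : Type*} [AddCommGroup G] [PartialOrder G] [IsOrderedAddMonoid G]
variable {H : Type*} [AddCommGroup H] [PartialOrder H] [IsOrderedAddMonoid H]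

theorem abs_sub_le_mul_of_forall_normalizedTraces {u : G} (hu : IsOrderUnit u) {φ : G →+ ℝ}
    (hφ : ∀ g, 0 ≤ g → 0 ≤ φ g) {x y : G} {r δ : ℝ}
    (h : ∀ θ ∈ normalizedTraces G u, |θ x - r * θ y| < δ) : |φ x - r * φ y| ≤ δ * φ u := by
  rcases (hφ u hu.1).eq_or_lt with h0 | h0
  · have hz : ∀ g, φ g = 0 := fun g => by
      obtain ⟨N, _, hN⟩ := hu.exists_bound g
      simpa [← h0] using hN φ hφ
    simp [hz]
  · have h1 := h ((φ u)⁻¹ • φ) (mem_normalizedTraces_of_nonneg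
      (fun g hg => mul_nonneg (inv_nonneg.2 h0.le) (hφ g hg)) (inv_mul_cancel₀ h0.ne'))
    change |(φ u)⁻¹ * φ x - r * ((φ u)⁻¹ * φ y)| < δ at h1
    rw [show (φ u)⁻¹ * φ x - r * ((φ u)⁻¹ * φ y) = (φ x - r * φ y) / φ u by ring, abs_div,
      abs_of_pos h0, div_lt_iff₀ h0] at h1
    exact h1.le

/-- A uniform approximation in `G` remains one, up to a constant, after tensoring with `h`. -/
theorem exists_slice_bound (hH : IsDimensionGroup H) {u : G} {v : H} (hu : IsOrderUnit u)
    (hv : IsOrderUnit v) (h : H) :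
    ∃ C : ℝ, 0 < C ∧ ∀ (x y : G) (r δ : ℝ), (∀ θ ∈ normalizedTraces G u, |θ x - r * θ y| < δ) →
      ∀ θ ∈ normalizedTraces (G ⊗[ℤ] H) (u ⊗ₜ[ℤ] v),
        |θ (x ⊗ₜ[ℤ] h) - r * θ (y ⊗ₜ[ℤ] h)| ≤ δ * C := by
  -- The slices of θ at p and q are positive maps on G of total mass at most M and N, whence C = M +
  -- N.
  obtain ⟨p, q, hp, hq, rfl⟩ := hH.directed h
  obtain ⟨M, hM, hMp⟩ := hv.exists_bound p
  obtain ⟨N, hN, hNq⟩ := hv.exists_bound q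
  refine ⟨M + N, by positivity, fun x y r δ hxy θ hθ => ?_⟩
  have hpos : ∀ h, 0 ≤ h → ∀ g, 0 ≤ g → 0 ≤ leftSlice θ h g := fun h hh g hg =>
    hθ.1.2 _ (tmul_nonneg hg hh)
  have h1 := abs_sub_le_mul_of_forall_normalizedTraces hu (hpos p hp) hxy
  have h2 := abs_sub_le_mul_of_forall_normalizedTraces hu (hpos q hq) hxy
  have hposu : ∀ h, 0 ≤ h → 0 ≤ rightSlice θ u h := fun h hh => hθ.1.2 _ (tmul_nonneg hu.1 hh)
  have h3 := (le_abs_self _).trans (hMp _ hposu)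
  have h4 := (le_abs_self _).trans (hNq _ hposu)
  simp only [leftSlice_apply, rightSlice_apply, hθ.2, mul_one] at h1 h2 h3 h4
  have hδ : 0 < δ := by
    have := hxy (leftSlice θ v) (mem_normalizedTraces_of_nonneg (hpos v hv.1) hθ.2)
    exact (abs_nonneg _).trans_lt this
  simp only [TensorProduct.tmul_sub, map_sub]
  have h5 := mul_le_mul_of_nonneg_left h3 hδ.le
  have h6 := mul_le_mul_of_nonneg_left h4 hδ.le
  have h7 := abs_sub (θ (x ⊗ₜ[ℤ] p) - r * θ (y ⊗ₜ[ℤ] p)) (θ (x ⊗ₜ[ℤ] q) - r * θ (y ⊗ₜ[ℤ] q))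
  rw [show θ (x ⊗ₜ[ℤ] p) - θ (x ⊗ₜ[ℤ] q) - r * (θ (y ⊗ₜ[ℤ] p) - θ (y ⊗ₜ[ℤ] q)) =
    θ (x ⊗ₜ[ℤ] p) - r * θ (y ⊗ₜ[ℤ] p) - (θ (x ⊗ₜ[ℤ] q) - r * θ (y ⊗ₜ[ℤ] q)) by ring, mul_add]
  linarith

theorem tensor_exists_approx_smul (hG : IsDimensionGroup G) (hH : IsDimensionGroup H)
    (hdiv : IsApproximatelyDivisible G) {u : G} {v : H} (hu : IsOrderUnit u) (hv : IsOrderUnit v)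
    (z : G ⊗[ℤ] H) (r : ℝ) {ε : ℝ} (hε : 0 < ε) :
    ∃ y, ∀ θ ∈ normalizedTraces (G ⊗[ℤ] H) (u ⊗ₜ[ℤ] v), |θ y - r * θ z| < ε := by
  induction z using TensorProduct.induction_on generalizing ε with
  | zero => exact ⟨0, fun θ _ => by simpa using hε⟩
  | tmul g h =>
    obtain ⟨C, hC, hbound⟩ := exists_slice_bound (G := G) hH hu hv h
    obtain ⟨y, hy⟩ := hG.exists_approx_smul hdiv hu g r (ε := ε / (2 * C)) (by positivity)
    refine ⟨y ⊗ₜ[ℤ] h, fun θ hθ => (hbound y g r _ hy θ hθ).trans_lt ?_⟩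
    rw [show ε / (2 * C) * C = ε / 2 by field_simp]
    linarith
  | add a b ha hb =>
    obtain ⟨x, hx⟩ := ha (ε := ε / 2) (by positivity)
    obtain ⟨y, hy⟩ := hb (ε := ε / 2) (by positivity)
    refine ⟨x + y, fun θ hθ => ?_⟩
    have h1 := abs_lt.1 (hx θ hθ)
    have h2 := abs_lt.1 (hy θ hθ)
    rw [map_add, map_add, abs_lt]
    constructor <;> linarith

/-- On a pure tensor, θ(s ⊗ t) ≈ σ(g) θ(u ⊗ t) ≈ σ(g) τ(h), using that slices of θ are traces up to
scaling. The factor t is chosen first because the precision needed for s depends on it. -/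
theorem tensor_exists_approx_const (hG : IsDimensionGroup G) (hH : IsDimensionGroup H)
    (hGdiv : IsApproximatelyDivisible G) (hHdiv : IsApproximatelyDivisible H) {u : G} {v : H}
    (hu : IsOrderUnit u) (hv : IsOrderUnit v) {σ : G →+ ℝ} {τ : H →+ ℝ}
    (hσ : σ ∈ normalizedTraces G u) (hτ : τ ∈ normalizedTraces H v)
    (hσg : IsOrderUnitGood σ) (hτg : IsOrderUnitGood τ) (z : G ⊗[ℤ] H) {ε : ℝ} (hε : 0 < ε) :
    ∃ s, tensorTrace σ τ s = tensorTrace σ τ z ∧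
      ∀ θ ∈ normalizedTraces (G ⊗[ℤ] H) (u ⊗ₜ[ℤ] v), |θ s - tensorTrace σ τ z| < ε := by
  induction z using TensorProduct.induction_on generalizing ε with
  | zero => exact ⟨0, rfl, fun θ _ => by simpa using hε⟩
  | tmul g h =>
    obtain ⟨t, ht, htθ⟩ := hH.exists_approx_const hHdiv hv hτ hτg h
      (ε := ε / (2 * (|σ g| + 1))) (by positivity)
    obtain ⟨C, hC, hbound⟩ := exists_slice_bound (G := G) hH hu hv t
    obtain ⟨s, hs, hsθ⟩ := hG.exists_approx_const hGdiv hu hσ hσg g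
      (ε := ε / (4 * C)) (by positivity)
    refine ⟨s ⊗ₜ[ℤ] t, by rw [tensorTrace_tmul, tensorTrace_tmul, hs, ht], fun θ hθ => ?_⟩
    have h1 := hbound s u (σ g) _ (fun θ' hθ' => by simpa [hθ'.2] using hsθ θ' hθ') θ hθ
    have h2 := htθ (rightSlice θ u) (mem_normalizedTraces_of_nonneg
      (fun h hh => hθ.1.2 _ (tmul_nonneg hu.1 hh)) hθ.2)
    rw [rightSlice_apply] at h2
    rw [show ε / (4 * C) * C = ε / 4 by field_simp] at h1
    have h3 : |σ g| * |θ (u ⊗ₜ[ℤ] t) - τ h| ≤ (|σ g| + 1) * (ε / (2 * (|σ g| + 1))) :=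
      mul_le_mul (by linarith) h2.le (abs_nonneg _) (by positivity)
    rw [show (|σ g| + 1) * (ε / (2 * (|σ g| + 1))) = ε / 2 by
      have : |σ g| + 1 ≠ 0 := by positivity
      field_simp, ← abs_mul] at h3
    rw [tensorTrace_tmul, show θ (s ⊗ₜ[ℤ] t) - σ g * τ h =
      (θ (s ⊗ₜ[ℤ] t) - σ g * θ (u ⊗ₜ[ℤ] t)) + σ g * (θ (u ⊗ₜ[ℤ] t) - τ h) by ring]
    refine (abs_add_le _ _).trans_lt ?_
    linarith
  | add a b ha hb =>
    obtain ⟨x, hx, hxθ⟩ := ha (ε := ε / 2) (by positivity)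
    obtain ⟨y, hy, hyθ⟩ := hb (ε := ε / 2) (by positivity)
    refine ⟨x + y, by rw [map_add, map_add, hx, hy], fun θ hθ => ?_⟩
    have h1 := abs_lt.1 (hxθ θ hθ)
    have h2 := abs_lt.1 (hyθ θ hθ)
    rw [map_add, map_add, abs_lt]
    constructor <;> linarith

theorem isOrderUnitGood_tensorTrace_of_normalized (hG : IsDimensionGroup G)
    (hH : IsDimensionGroup H) (hGdiv : IsApproximatelyDivisible G)
    (hHdiv : IsApproximatelyDivisible H) {u : G} {v : H} (hu : IsOrderUnit u)
    (hv : IsOrderUnit v) {σ : G →+ ℝ} {τ : H →+ ℝ} (hσ : σ ∈ normalizedTraces G u)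
    (hτ : τ ∈ normalizedTraces H v) (hσg : IsOrderUnitGood σ) (hτg : IsOrderUnitGood τ) :
    IsOrderUnitGood (tensorTrace σ τ) := by
  intro a b ha _ hb hab
  set ρ := tensorTrace σ τ with hρdef
  have hρ : ρ ∈ normalizedTraces (G ⊗[ℤ] H) (u ⊗ₜ[ℤ] v) := tensorTrace_mem_normalizedTraces hσ hτ
  rcases (hρ.1.2 a ha).eq_or_lt with h0 | hapos
  · exact ⟨0, le_rfl, hb.1, by rw [map_zero, h0]⟩
  have hw := hu.tmul hv
  have hbpos : 0 < ρ b := hapos.trans hab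
  obtain ⟨n, hn, hnb⟩ := hb.exists_bound (u ⊗ₜ[ℤ] v)
  have hn' : (0 : ℝ) < n := by exact_mod_cast hn
  have hbn : ∀ θ ∈ normalizedTraces (G ⊗[ℤ] H) (u ⊗ₜ[ℤ] v), 1 / (n : ℝ) ≤ θ b := by
    intro θ hθ
    have := hnb θ hθ.1.2
    rw [hθ.2, abs_one] at this
    rw [div_le_iff₀ hn']
    linarith
  set r : ℝ := ρ a / ρ b with hr
  have hr0 : 0 < r := div_pos hapos hbpos
  have hr1 : 0 < 1 - r := by
    rw [sub_pos, hr, div_lt_one hbpos]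
    exact hab
  have hrb : r * ρ b = ρ a := div_mul_cancel₀ _ hbpos.ne'
  -- Since θ(b) ≥ 1/n, both r θ(b) and (1 - r) θ(b) are at least 4ε, which beats the total error 3ε:
  -- one ε each from b', from d, and from ρ(a - b').
  set ε : ℝ := min r (1 - r) / (4 * n) with hε
  have hmin : 0 < min r (1 - r) := lt_min hr0 hr1
  have hε0 : 0 < ε := by positivity
  have hεn : min r (1 - r) * (1 / n) = 4 * ε := by
    rw [hε]
    field_simp
  obtain ⟨b', hb'⟩ := tensor_exists_approx_smul hG hH hGdiv hu hv b r hε0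
  obtain ⟨d, hd, hdθ⟩ := tensor_exists_approx_const hG hH hGdiv hHdiv hu hv hσ hτ hσg hτg
    (a - b') hε0
  rw [← hρdef] at hd hdθ
  have hρb' := abs_lt.1 (hb' ρ hρ)
  have hdb : ∀ θ ∈ normalizedTraces (G ⊗[ℤ] H) (u ⊗ₜ[ℤ] v), |θ (b' + d) - r * θ b| < 3 * ε := by
    intro θ hθ
    have h1 := abs_lt.1 (hb' θ hθ)
    have h2 := abs_lt.1 (hdθ θ hθ)
    rw [map_sub] at h2
    rw [map_add, abs_lt]
    constructor <;> linarith
  have hlow : ∀ s : ℝ, min r (1 - r) ≤ s → ∀ θ ∈ normalizedTraces (G ⊗[ℤ] H) (u ⊗ₜ[ℤ] v),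
      4 * ε ≤ s * θ b := by
    intro s hs θ hθ
    rw [← hεn]
    exact mul_le_mul hs (hbn θ hθ) (by positivity) (hmin.le.trans hs)
  have hunperf := tensor_unperforated hG hH
  refine ⟨b' + d, hw.nonneg_of_forall_pos hunperf _ fun θ hθ => ?_,
    sub_nonneg.1 (hw.nonneg_of_forall_pos hunperf _ fun θ hθ => ?_), ?_⟩
  · have h1 := abs_lt.1 (hdb θ hθ)
    have h2 := hlow r (min_le_left _ _) θ hθ
    linarith
  · have h1 := abs_lt.1 (hdb θ hθ)
    have h2 := hlow (1 - r) (min_le_right _ _) θ hθ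
    rw [map_sub]
    linarith
  · rw [map_add, hd, map_sub]
    ring

theorem IsOrderUnitGood.smul {K : Type*} [AddCommGroup K] [Preorder K] {θ : K →+ ℝ}
    (h : IsOrderUnitGood θ) {r : ℝ} (hr : 0 < r) : IsOrderUnitGood (r • θ) := by
  intro a b ha ha0 hb hab
  change r * θ a < r * θ b at hab
  obtain ⟨c, hc0, hcb, hc⟩ := h a b ha ha0 hb (lt_of_mul_lt_mul_left hab hr.le)
  exact ⟨c, hc0, hcb, congrArg (r * ·) hc⟩

theorem IsTrace.inv_smul_mem_normalizedTraces {u : G} (hu : IsOrderUnit u) {σ : G →+ ℝ}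
    (hσ : IsTrace σ) : (σ u)⁻¹ • σ ∈ normalizedTraces G u := by
  have h0 := hu.pos_of_isTrace hσ
  exact mem_normalizedTraces_of_nonneg
    (fun g hg => mul_nonneg (inv_nonneg.2 h0.le) (hσ.2 g hg)) (inv_mul_cancel₀ h0.ne')

theorem isOrderUnitGood_tensorTrace (hG : IsDimensionGroup G) (hH : IsDimensionGroup H)
    (hGdiv : IsApproximatelyDivisible G) (hHdiv : IsApproximatelyDivisible H) {σ : G →+ ℝ}
    {τ : H →+ ℝ} (hσ : IsTrace σ) (hτ : IsTrace τ) (hσg : IsOrderUnitGood σ)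
    (hτg : IsOrderUnitGood τ) : IsOrderUnitGood (tensorTrace σ τ) := by
  obtain ⟨u, hu⟩ := hGdiv.1
  obtain ⟨v, hv⟩ := hHdiv.1
  have hσ0 := hu.pos_of_isTrace hσ
  have hτ0 := hv.pos_of_isTrace hτ
  have h := isOrderUnitGood_tensorTrace_of_normalized hG hH hGdiv hHdiv hu hv
    (hσ.inv_smul_mem_normalizedTraces hu) (hτ.inv_smul_mem_normalizedTraces hv)
    (hσg.smul (inv_pos.2 hσ0)) (hτg.smul (inv_pos.2 hτ0))
  have h' := h.smul (mul_pos hσ0 hτ0)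
  rwa [← tensorTrace_smul_smul, smul_inv_smul₀ hσ0.ne', smul_inv_smul₀ hτ0.ne'] at h'

theorem isPureTrace_tensorTrace (hH : IsDimensionGroup H) {σ : G →+ ℝ} {τ : H →+ ℝ}
    (hσ : IsPureTrace σ) (hτ : IsPureTrace τ) : IsPureTrace (tensorTrace σ τ) := by
  obtain ⟨hσt, u, hu, hσe⟩ := hσ
  obtain ⟨hτt, v, hv, hτe⟩ := hτ
  have hpos : 0 < tensorTrace σ τ (u ⊗ₜ[ℤ] v) := by
    rw [tensorTrace_tmul]
    exact mul_pos (hu.pos_of_isTrace hσt) (hv.pos_of_isTrace hτt)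
  refine ⟨⟨fun h => hpos.ne' (by rw [h]; rfl), tensorTrace_nonneg hσt.2 hτt.2⟩, u ⊗ₜ[ℤ] v,
    hu.tmul hv, ?_⟩
  rw [tensorTrace_tmul, mul_inv, ← tensorTrace_smul_smul]
  exact tensorTrace_mem_extremePoints hH.directed hu hv hσe hτe

/-- The ordered tensor product of simple groups is simple. -/
theorem IsSimple.tensor (hG : IsSimple G) (hH : IsSimple H) : IsSimple (G ⊗[ℤ] H) := by
  intro z hz hz0
  rw [tensor_nonneg_iff] at hz
  induction hz using AddSubmonoid.closure_induction with
  | mem z hz =>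
    obtain ⟨g, h, hg, hh, rfl⟩ := hz
    exact (hG g hg (by rintro rfl; simp at hz0)).tmul (hH h hh (by rintro rfl; simp at hz0))
  | zero => exact absurd rfl hz0
  | add x y hxm hym hx hy =>
    by_cases hx0 : x = 0
    · subst hx0
      rw [zero_add] at hz0 ⊢
      exact hy hz0
    · exact (hx hx0).mono (le_add_of_nonneg_right (tensor_nonneg_iff.2 hym))

theorem IsGood.isOrderUnitGood {G : Type*} [AddCommGroup G] [PartialOrder G]
    {σ : G →+ ℝ} (hσ : ∀ g, 0 ≤ g → 0 ≤ σ g) (h : IsGood σ) :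
    IsOrderUnitGood σ := fun a b ha ha0 hb hab =>
  h a b ha ha0 hb.1 (by
    rintro rfl
    rw [map_zero] at hab
    exact absurd (hσ a ha) (not_le.2 hab)) hab

end TensorApproximation

end DimGroup

theorem proposition5p2 {G H : Type*}
    [AddCommGroup G] [PartialOrder G] [IsOrderedAddMonoid G]
    [AddCommGroup H] [PartialOrder H] [IsOrderedAddMonoid H]
    (hG : DimGroup.IsDimensionGroup G) (hH : DimGroup.IsDimensionGroup H)
    (hGdiv : DimGroup.IsApproximatelyDivisible G) (hHdiv : DimGroup.IsApproximatelyDivisible H)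
    (σ : G →+ ℝ) (τ : H →+ ℝ)
    (hσ : DimGroup.IsPureTrace σ) (hτ : DimGroup.IsPureTrace τ) :
    DimGroup.IsPureTrace (DimGroup.tensorTrace σ τ) ∧
    (DimGroup.IsOrderUnitGood σ → DimGroup.IsOrderUnitGood τ →
      DimGroup.IsOrderUnitGood (DimGroup.tensorTrace σ τ)) ∧
    (DimGroup.IsSimple G → DimGroup.IsSimple H → DimGroup.IsGood σ → DimGroup.IsGood τ →
      DimGroup.IsGood (DimGroup.tensorTrace σ τ)) := by
  have hgood := DimGroup.isOrderUnitGood_tensorTrace hG hH hGdiv hHdiv hσ.1 hτ.1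
  refine ⟨DimGroup.isPureTrace_tensorTrace hH hσ hτ, hgood, ?_⟩
  intro hGs hHs hσg hτg a b ha ha0 hb hb0 hab
  -- Simplicity passes to the tensor product, so b is automatically an order unit.
  exact hgood (hσg.isOrderUnitGood hσ.1.2) (hτg.isOrderUnitGood hτ.1.2) a b ha ha0
    (hGs.tensor hHs b hb hb0) hab
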